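/- Let $\Omega\subset\mathbb R^3$ be a bounded domain with $C^2$ boundary and outward unit normal $\nu$, let $\epsilon_0,\mu_0>0$ and $\omega$ be constants with wave number $k:=\omega\sqrt{\epsilon_0\mu_0}\ge 1$, and assume that $\omega$ is not an eigenvalue, i.e. the unperturbed system below has only the zero solution in $H(\Omega;\mathrm{curl})^2$ with $E\times\nu=0$ on $\partial\Omega$. Let $\sigma\in L^\infty(\Omega)\cap H^1(\Omega)$ be real-valued, with $\sigma=0$ on $\partial\Omega$ and $\|\sigma\|_{H^1(\Omega)}\le M_1$. Let $TH(\partial\Omega)$ be the space of tangential traces $u\times\nu|_{\partial\Omega}$ of fields $u\in H(\Omega;\mathrm{curl})$ with the norm $\|g\|_{TH(\partial\Omega)}=\inf\{\|u\|_{L^2(\Omega)}+\|\mathrm{curl}\,u\|_{L^2(\Omega)}: u\times\nu=g\}$. For $g\in TH(\partial\Omega)$ let $(E_0,H_0)\in H(\Omega;\mathrm{curl})^2$ solve the unperturbed system $$\mathrm{curl}\,E_0-i\omega\mu_0H_0=0,\quad \mathrm{curl}\,H_0+i\omega\epsilon_0E_0=0\ \text{ in }\Omega,\qquad E_0\times\nu=g\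 \text{ on }\partial\Omega,$$ and let $(E_1,H_1)\in H(\Omega;\mathrm{curl})^2$ solve $$\mathrm{curl}\,E_1-i\omega\mu_0H_1=0,\quad \mathrm{curl}\,H_1+i\omega\epsilon_0E_1=\sigma E_0\ \text{ in }\Omega,\qquad E_1\times\nu=0\ \text{ on }\partial\Omega.$$ Let $\varepsilon>0$ be the operator norm, from $TH(\partial\Omega)$ to $TH(\partial\Omega)$, of the linearised boundary map $\Lambda':g=E_0\times\nu\mapsto H_1\times\nu$, and assume $\varepsilon<1$. Put $\mathcal E=-\ln\varepsilon$, and $\chi=0$ if $\mathcal E<k$, $\chi=1$ if $k\le\mathcal E$. Let $D$ be the diameter of $\Omega$, $\mathrm{Vol}(\Omega)$ its volume and $\mathrm{Vol}_2(\Omega)$ the supremum of the areas of its orthogonal projections onto planes. Then for every $0<\alpha\le1$ $$\begin{aligned}\|\sigma\|^2_{L^2(\Omega)}\le{}&\frac{4}{3\pi^2}\mathrm{Vol}(\Omega)^2\Big((1-\chi)(1+k)^4k^{3\alpha}+\chi(1+\mathcal E)^4\mathcal E^3\Big)\varepsilon^2\\&+\chi\,\frac1{4\pi^2}\mathrm{Vol}_2(\Omega)^2\frac1D\big(1+(2D)^2\big)^{1/2}(1+\mathcal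 E)^4\mathcal E\,\varepsilon\\&+M_1^2\Big((1-\chi)\frac1{1+2\mathcal E^{2\alpha}+2k^{2\alpha}}+\chi\,\frac1{1+\mathcal E^2/D^2+4k^2}\Big).\end{aligned}$$ -/

import Mathlib

open MeasureTheory
open scoped ENNReal Gradient

noncomputable section

/-- Euclidean space `ℝ³`. -/
abbrev R3 : Type := EuclideanSpace ℝ (Fin 3)

/-- The space `ℂ³` (with its Hermitian norm) in which the fields take their values. -/
abbrev C3 : Type := EuclideanSpace ℂ (Fin 3)

/-- A bounded domain of class `C²`: a bounded connected open set which, near each of its boundary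
points, is the sublevel set `{ψ < 0}` of a `C²` function with nonvanishing differential. -/
structure IsBoundedC2Domain (Ω : Set R3) : Prop where
  isOpen : IsOpen Ω
  isConnected : IsConnected Ω
  isBounded : Bornology.IsBounded Ω
  boundary : ∀ p ∈ frontier Ω, ∃ U : Set R3, IsOpen U ∧ p ∈ U ∧ ∃ ψ : R3 → ℝ,
    ContDiffOn ℝ 2 ψ U ∧ fderiv ℝ ψ p ≠ 0 ∧ Ω ∩ U = {x ∈ U | ψ x < 0}

/-- `Vol(Ω)`, the volume of `Ω`. -/
def vol3 (Ω : Set R3) : ℝ := (volume Ω).toReal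

/-- `Vol₂(Ω)`, the supremum of the areas of the orthogonal projections of `Ω` onto
two-dimensional subspaces. -/
def vol2 (Ω : Set R3) : ℝ :=
  (⨆ (K : Submodule ℝ R3) (_ : Module.finrank ℝ K = 2),
    volume ((fun x : R3 => K.orthogonalProjectionOnto x) '' Ω)).toReal

/-- `φ` is a smooth function with compact support contained in `Ω`. -/
def IsTestFunction {F : Type*} [NormedAddCommGroup F] [NormedSpace ℝ F]
    (Ω : Set R3) (φ : R3 → F) : Prop :=
  ContDiff ℝ (⊤ : ℕ∞) φ ∧ HasCompactSupport φ ∧ tsupport φ ⊆ Ω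

/-- Real valued functions of the Sobolev space `H¹(Ω)`, with their weak gradient. -/
structure SobolevH1 (Ω : Set R3) where
  /-- the function -/
  val : R3 → ℝ
  /-- its weak gradient -/
  grad : R3 → R3
  memLp_val : MemLp val 2 (volume.restrict Ω)
  memLp_grad : MemLp grad 2 (volume.restrict Ω)
  weak_grad : ∀ φ : R3 → ℝ, IsTestFunction Ω φ →
    ∫ x in Ω, val x • ∇ φ x = - ∫ x in Ω, φ x • grad x

/-- The norm `‖σ‖₍₁₎(Ω)` of `H¹(Ω)`. -/
def SobolevH1.norm {Ω : Set R3} (σ : SobolevH1 Ω) : ℝ :=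
  Real.sqrt ((∫ x in Ω, σ.val x ^ 2) + ∫ x in Ω, ‖σ.grad x‖ ^ 2)

/-- `σ = 0` on `∂Ω`: `σ` lies in `H¹₀(Ω)`, the closure in `H¹(Ω)` of the test functions. -/
def SobolevH1.VanishesOnBoundary {Ω : Set R3} (σ : SobolevH1 Ω) : Prop :=
  ∀ δ : ℝ≥0∞, 0 < δ → ∃ φ : R3 → ℝ, IsTestFunction Ω φ ∧
    eLpNorm (fun x => σ.val x - φ x) 2 (volume.restrict Ω) < δ ∧
    eLpNorm (fun x => σ.grad x - ∇ φ x) 2 (volume.restrict Ω) < δ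

/-- The partial derivative `∂ᵢ φⱼ` at `x`. -/
def partialD (i j : Fin 3) (φ : R3 → C3) (x : R3) : ℂ :=
  fderiv ℝ φ x (EuclideanSpace.single i (1 : ℝ)) j

/-- The classical curl of a differentiable field. -/
def curl (φ : R3 → C3) (x : R3) : C3 :=
  !₂[partialD 1 2 φ x - partialD 2 1 φ x,
     partialD 2 0 φ x - partialD 0 2 φ x,
     partialD 0 1 φ x - partialD 1 0 φ x]

/-- The bilinear (not sesquilinear) product `v · w` on `ℂ³`. -/
def cdot (v w : C3) : ℂ := ∑ i, v i * w i

/-- Elements of `H(Ω; curl)`: square integrable fields on `Ω`, with their square integrable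
weak curl. -/
structure HCurl (Ω : Set R3) where
  /-- the field -/
  val : R3 → C3
  /-- its weak curl -/
  rot : R3 → C3
  memLp_val : MemLp val 2 (volume.restrict Ω)
  memLp_rot : MemLp rot 2 (volume.restrict Ω)
  weak_curl : ∀ φ : R3 → C3, IsTestFunction Ω φ →
    ∫ x in Ω, cdot (val x) (curl φ x) = ∫ x in Ω, cdot (rot x) (φ x)

/-- The norm `‖u‖₍₀₎(Ω) + ‖curl u‖₍₀₎(Ω)`. -/
def HCurl.norm {Ω : Set R3} (u : HCurl Ω) : ℝ≥0∞ :=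
  eLpNorm u.val 2 (volume.restrict Ω) + eLpNorm u.rot 2 (volume.restrict Ω)

/-- Fields that are smooth up to the boundary (restrictions of smooth fields on `ℝ³`). -/
def SmoothField : Type := {φ : R3 → C3 // ContDiff ℝ (⊤ : ℕ∞) φ}

/-- Candidates for tangential traces, as functionals on the smooth fields. -/
abbrev BoundaryFunctional : Type := SmoothField → ℂ

/-- The tangential trace `u × ν` on `∂Ω` of a field `u` in `H(Ω; curl)`. It is the functional
`w ↦ ∫_∂Ω (u × ν) · w dS`, which for general `u` is defined by Green's identity
`∫_∂Ω (u × ν) · w dS = ∫_Ω (u · curl w - curl u · w) dx`. -/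
def HCurl.trace {Ω : Set R3} (u : HCurl Ω) : BoundaryFunctional :=
  fun w => ∫ x in Ω, (cdot (u.val x) (curl w.1 x) - cdot (u.rot x) (w.1 x))

/-- The space `TH(∂Ω)` of the tangential traces of the fields in `H(Ω; curl)`. -/
def TH (Ω : Set R3) : Set BoundaryFunctional := Set.range (HCurl.trace (Ω := Ω))

/-- The norm of `TH(∂Ω)`: the infimum of the norms of the fields `u` with `u × ν = g`. -/
def normTH (Ω : Set R3) (g : BoundaryFunctional) : ℝ≥0∞ :=
  ⨅ (u : HCurl Ω) (_ : u.trace = g), u.norm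

/-- `(E, H)` in `H(Ω; curl)²` solves
`curl E - i ω μ₀ H = 0`, `curl H + i ω ε₀ E = J` in `Ω`. -/
def SolvesMaxwell {Ω : Set R3} (ω ε₀ μ₀ : ℝ) (J : R3 → C3) (E H : HCurl Ω) : Prop :=
  (∀ᵐ x ∂(volume.restrict Ω), E.rot x - (Complex.I * ω * μ₀) • H.val x = 0) ∧
  (∀ᵐ x ∂(volume.restrict Ω), H.rot x + (Complex.I * ω * ε₀) • E.val x = J x)

/-- `ω` is an eigenvalue: the homogeneous system with boundary condition `E × ν = 0` has a
nonzero solution. -/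
def IsMaxwellEigenvalue (Ω : Set R3) (ω ε₀ μ₀ : ℝ) : Prop :=
  ∃ E H : HCurl Ω, SolvesMaxwell ω ε₀ μ₀ 0 E H ∧ E.trace = 0 ∧
    ¬ (E.val =ᵐ[volume.restrict Ω] 0 ∧ H.val =ᵐ[volume.restrict Ω] 0)

/-- The graph of the linearised boundary map `Λ' : E(;0) × ν ↦ H(;1) × ν`, where
`(E(;0), H(;0))` solves the unperturbed system, and `(E(;1), H(;1))` solves the system with source
`σ E(;0)` and boundary condition `E(;1) × ν = 0`. -/
def LinearisedMap (Ω : Set R3) (ω ε₀ μ₀ : ℝ) (σ : R3 → ℝ) (g h : BoundaryFunctional) : Prop :=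
  ∃ E0 H0 E1 H1 : HCurl Ω,
    SolvesMaxwell ω ε₀ μ₀ 0 E0 H0 ∧ E0.trace = g ∧
    SolvesMaxwell ω ε₀ μ₀ (fun x => (σ x : ℂ) • E0.val x) E1 H1 ∧ E1.trace = 0 ∧
    H1.trace = h

/-- The operator norm of `Λ'` from `TH(∂Ω)` to `TH(∂Ω)`: the least `C` such that
`‖Λ' g‖ ≤ C ‖g‖` for all `g` in `TH(∂Ω)`. When `ω` is not an eigenvalue, the `h` below is unique,
it is `Λ' g`. -/
def linearisedMapNorm (Ω : Set R3) (ω ε₀ μ₀ : ℝ) (σ : R3 → ℝ) : ℝ≥0∞ :=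
  sInf {C : ℝ≥0∞ | ∀ g ∈ TH Ω, ∃ h, LinearisedMap Ω ω ε₀ μ₀ σ g h ∧
    normTH Ω h ≤ C * normTH Ω g}

/-- The switch `χ_k(𝓔)`, equal to `0` if `𝓔 < k` and to `1` if `k ≤ 𝓔`. -/
def chi (k e : ℝ) : ℝ := if e < k then 0 else 1

end

/-!
The proof tests the linearised boundary map against plane waves with complex wave vectors and turns
the resulting bound on the Fourier transform of `σ` at low frequencies into a bound on `σ`.

If `E₀` solves the unperturbed system, `(E₁, H₁)` the system with source `σ E₀`, and `w` is a smooth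
solution of `curl curl w = k² w`, Green's identity shows that the trace `H₁ × ν` tested against `w`
is `-∫ σ E₀ · w` (`trace_eq_neg_integral`). Take for `E₀` and `w` plane waves `exp(i ζ · x) η` and
`exp(i ζ' · x) η'` with `ζ · ζ = ζ' · ζ' = k²`, `ζ ⊥ η`, `ζ' ⊥ η'`, `η · η' = 1`: as `ω` is not an
eigenvalue, `E₀` is the field that enters in the definition of the boundary map, and
`|∫ σ exp(i (ζ + ζ') · x)|` is at most `ε (1 + k) k` times the product of the `L²(Ω)` norms of the
two exponentials (`planeWaveBound`). All frequencies `ξ = ζ + ζ'` are reached.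

* If `|ξ| ≤ 2 k`, real wave vectors do, and the two norms are `Vol(Ω)^(1/2)`
  (`norm_domainFourier_le_of_low`).
* If `|ξ| > 2 k`, take `ζ = ξ / 2 + i τ f` and `ζ' = ξ / 2 - i τ f` with `f` a unit vector orthogonal
  to `ξ` and `τ² = |ξ|² / 4 - k²`. Slicing `Ω` orthogonally to `f` bounds the product of the two norms
  by `Vol₂(Ω) exp(τ D) (1 - exp(-2 τ D)) / (2 τ)` (`norm_sq_domainFourier_le_of_high`). The
  polarisations have to lie in the plane of `ξ` and `f`: the curl of the wave is then at most `k` times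
  the wave, while for `η` orthogonal to that plane it would be `|ζ|` times the wave, which cannot be
  bounded by `1 + 𝓔` when `D` is small.

Since `σ` lies in `H¹₀(Ω)`, Plancherel's theorem for test functions and a limit give
`‖σ‖² ≤ ∫_{|ξ| < R} |σ̂|² + M₁² / (1 + R²)` (`SobolevH1.integral_sq_le`). With
`R² = 2 𝓔^(2α) + 2 k^(2α)` when `𝓔 < k`, only low frequencies occur. With `R² = 𝓔² / D² + 4 k²` when
`k ≤ 𝓔`, the high ones have `2 τ D ≤ 𝓔`, so that the growth `exp(2 τ D)` of the evanescent waves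
costs only one of the two factors `ε`; integrating over the annulus `2 k < |ξ| < R` in polar
coordinates gives the term with `Vol₂(Ω)` (`setIntegral_high_le`).
-/

/-! ### The bilinear product and traces -/

lemma norm_cdot_le (v w : C3) : ‖cdot v w‖ ≤ ‖v‖ * ‖w‖ := by
  have h : cdot v w = inner ℂ (WithLp.toLp 2 (fun i => star (v i)) : C3) w := by
    simp [cdot, PiLp.inner_apply, mul_comm]
  have hv : ‖(WithLp.toLp 2 (fun i => star (v i)) : C3)‖ = ‖v‖ := by
    simp [EuclideanSpace.norm_eq]
  rw [h, ← hv]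
  exact norm_inner_le_norm _ _

lemma continuous_cdot : Continuous fun p : C3 × C3 => cdot p.1 p.2 := by
  unfold cdot; fun_prop

lemma cdot_add_left (u v w : C3) : cdot (u + v) w = cdot u w + cdot v w := by
  simp [cdot, Fin.sum_univ_three]; ring

lemma cdot_sub_left (u v w : C3) : cdot (u - v) w = cdot u w - cdot v w := by
  simp [cdot, Fin.sum_univ_three]; ring

lemma cdot_smul_left (c : ℂ) (v w : C3) : cdot (c • v) w = c * cdot v w := by
  simp [cdot, Fin.sum_univ_three]; ring

lemma cdot_smul_right (c : ℂ) (v w : C3) : cdot v (c • w) = c * cdot v w := by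
  simp [cdot, Fin.sum_univ_three]; ring

lemma cdot_comm (v w : C3) : cdot v w = cdot w v := by
  simp [cdot, mul_comm]

lemma eLpNorm_cdot_le {μ : Measure R3} {u w : R3 → C3} (hu : AEStronglyMeasurable u μ)
    (hw : AEStronglyMeasurable w μ) :
    eLpNorm (fun x => cdot (u x) (w x)) 1 μ ≤ eLpNorm u 2 μ * eLpNorm w 2 μ := by
  simpa using eLpNorm_le_eLpNorm_mul_eLpNorm_of_nnnorm (p := 2) (q := 2) (r := 1) hu hw cdot 1
    (Filter.Eventually.of_forall fun x => by
      rw [one_mul]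
      exact norm_cdot_le (u x) (w x))

lemma integrable_cdot {μ : Measure R3} {u w : R3 → C3} (hu : MemLp u 2 μ) (hw : MemLp w 2 μ) :
    Integrable (fun x => cdot (u x) (w x)) μ := by
  have hm : AEStronglyMeasurable (fun x => cdot (u x) (w x)) μ :=
    continuous_cdot.comp_aestronglyMeasurable (g := fun p : C3 × C3 => cdot p.1 p.2)
      (f := fun x => (u x, w x)) (hu.1.prodMk hw.1)
  exact memLp_one_iff_integrable.1 ⟨hm, (eLpNorm_cdot_le hu.1 hw.1).trans_lt (ENNReal.mul_lt_top hu.2 hw.2)⟩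

lemma enorm_integral_cdot_le {μ : Measure R3} {u w : R3 → C3} (hu : MemLp u 2 μ)
    (hw : MemLp w 2 μ) :
    ‖∫ x, cdot (u x) (w x) ∂μ‖ₑ ≤ eLpNorm u 2 μ * eLpNorm w 2 μ := by
  refine (enorm_integral_le_lintegral_enorm _).trans ?_
  rw [← eLpNorm_one_eq_lintegral_enorm]
  exact eLpNorm_cdot_le hu.1 hw.1

lemma Continuous.memLp_restrict_of_isBounded {F : Type*} [NormedAddCommGroup F] {Ω : Set R3}
    (hb : Bornology.IsBounded Ω) (ho : MeasurableSet Ω) {f : R3 → F} (hf : Continuous f)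
    (p : ℝ≥0∞) : MemLp f p (volume.restrict Ω) := by
  have : IsFiniteMeasure (volume.restrict Ω) := ⟨by simpa using hb.measure_lt_top⟩
  obtain ⟨C, hC⟩ := hb.isCompact_closure.exists_bound_of_continuousOn hf.continuousOn
  refine MemLp.of_bound hf.aestronglyMeasurable C ?_
  filter_upwards [ae_restrict_mem ho] with x hx using hC x (subset_closure hx)

/-! ### Smooth fields as elements of `H(Ω; curl)` -/

lemma partialD_eq {φ : R3 → C3} {x : R3} (hφ : DifferentiableAt ℝ φ x) (i j : Fin 3) :
    partialD i j φ x = fderiv ℝ (fun y => φ y j) x (EuclideanSpace.single i (1 : ℝ)) := by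
  have h := ((EuclideanSpace.proj j : C3 →L[ℂ] ℂ).restrictScalars ℝ).hasFDerivAt.comp x
    hφ.hasFDerivAt
  have h2 : HasFDerivAt (fun y => φ y j)
    (((EuclideanSpace.proj j : C3 →L[ℂ] ℂ).restrictScalars ℝ).comp (fderiv ℝ φ x)) x := h
  rw [h2.fderiv]
  rfl

lemma continuous_partialD {φ : R3 → C3} (hφ : ContDiff ℝ (⊤ : ℕ∞) φ) (i j : Fin 3) :
    Continuous (partialD i j φ) := by
  have : Continuous (fderiv ℝ φ) := hφ.continuous_fderiv (by simp)
  unfold partialD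
  fun_prop

lemma continuous_curl {φ : R3 → C3} (hφ : ContDiff ℝ (⊤ : ℕ∞) φ) : Continuous (curl φ) := by
  have := continuous_partialD hφ
  unfold curl
  refine (PiLp.continuous_toLp 2 _).comp (continuous_pi fun i => ?_)
  fin_cases i <;> simp <;> fun_prop

lemma integral_mul_partialD {F φ : R3 → C3} (hF : ContDiff ℝ (⊤ : ℕ∞) F)
    (hφ : ContDiff ℝ (⊤ : ℕ∞) φ) (hc : HasCompactSupport φ) (i j k : Fin 3) :
    Integrable (fun x => F x j * partialD i k φ x) ∧
    Integrable (fun x => partialD i j F x * φ x k) ∧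
    ∫ x, F x j * partialD i k φ x = - ∫ x, partialD i j F x * φ x k := by
  have dF : Differentiable ℝ F := hF.differentiable (by simp)
  have dφ : Differentiable ℝ φ := hφ.differentiable (by simp)
  have cF := continuous_partialD hF i j
  have cφ := continuous_partialD hφ i k
  have hck : HasCompactSupport (fun x => φ x k) := hc.comp_left (g := fun v : C3 => v k) rfl
  have hcd : HasCompactSupport (partialD i k φ) :=
    (hc.fderiv (𝕜 := ℝ)).comp_left (g := fun L : R3 →L[ℝ] C3 =>
      L (EuclideanSpace.single i (1 : ℝ)) k) rfl
  have c1 : Continuous fun x => F x j := by fun_prop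
  have c2 : Continuous fun x => φ x k := by fun_prop
  have i1 : Integrable (fun x => F x j * partialD i k φ x) :=
    (c1.mul cφ).integrable_of_hasCompactSupport hcd.mul_left
  have i2 : Integrable (fun x => partialD i j F x * φ x k) :=
    (cF.mul c2).integrable_of_hasCompactSupport hck.mul_left
  have i3 : Integrable (fun x => F x j * φ x k) :=
    (c1.mul c2).integrable_of_hasCompactSupport hck.mul_left
  refine ⟨i1, i2, ?_⟩
  have d1 : Differentiable ℝ (fun y => F y j) := by
    exact ((EuclideanSpace.proj j : C3 →L[ℂ] ℂ).restrictScalars ℝ).differentiable.comp dF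
  have d2 : Differentiable ℝ (fun y => φ y k) := by
    exact ((EuclideanSpace.proj k : C3 →L[ℂ] ℂ).restrictScalars ℝ).differentiable.comp dφ
  have e1 : partialD i j F = fun x => fderiv ℝ (fun y => F y j) x
    (EuclideanSpace.single i (1 : ℝ)) := funext fun x => partialD_eq (dF x) i j
  have e2 : partialD i k φ = fun x => fderiv ℝ (fun y => φ y k) x
    (EuclideanSpace.single i (1 : ℝ)) := funext fun x => partialD_eq (dφ x) i k
  rw [e1] at i2 ⊢
  rw [e2] at i1 ⊢
  exact integral_mul_fderiv_eq_neg_fderiv_mul_of_integrable i2 i1 i3 (fun x _ => d1 x)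
    (fun x _ => d2 x)

lemma integral_sub_add_sub_add_sub {f₁ f₂ f₃ f₄ f₅ f₆ : R3 → ℂ} (h₁ : Integrable f₁)
    (h₂ : Integrable f₂) (h₃ : Integrable f₃) (h₄ : Integrable f₄) (h₅ : Integrable f₅)
    (h₆ : Integrable f₆) :
    ∫ x, ((f₁ x - f₂ x) + (f₃ x - f₄ x) + (f₅ x - f₆ x)) =
      ((∫ x, f₁ x) - ∫ x, f₂ x) + ((∫ x, f₃ x) - ∫ x, f₄ x) + ((∫ x, f₅ x) - ∫ x, f₆ x) := by
  have h₁₂ : Integrable fun x => f₁ x - f₂ x := h₁.sub h₂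
  have h₃₄ : Integrable fun x => f₃ x - f₄ x := h₃.sub h₄
  have h₅₆ : Integrable fun x => f₅ x - f₆ x := h₅.sub h₆
  have h₁₄ : Integrable fun x => (f₁ x - f₂ x) + (f₃ x - f₄ x) := h₁₂.add h₃₄
  rw [integral_add h₁₄ h₅₆, integral_add h₁₂ h₃₄, integral_sub h₁ h₂, integral_sub h₃ h₄,
    integral_sub h₅ h₆]

lemma integral_cdot_curl {F φ : R3 → C3} (hF : ContDiff ℝ (⊤ : ℕ∞) F)
    (hφ : ContDiff ℝ (⊤ : ℕ∞) φ) (hc : HasCompactSupport φ) :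
    ∫ x, cdot (F x) (curl φ x) = ∫ x, cdot (curl F x) (φ x) := by
  have A i j k := (integral_mul_partialD hF hφ hc i j k).1
  have B i j k := (integral_mul_partialD hF hφ hc i j k).2.1
  have E i j k := (integral_mul_partialD hF hφ hc i j k).2.2
  have l : ∀ x, cdot (F x) (curl φ x) =
      (F x 0 * partialD 1 2 φ x - F x 0 * partialD 2 1 φ x)
      + (F x 1 * partialD 2 0 φ x - F x 1 * partialD 0 2 φ x)
      + (F x 2 * partialD 0 1 φ x - F x 2 * partialD 1 0 φ x) := fun x => by
    simp [cdot, curl, Fin.sum_univ_three]; ring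
  have r : ∀ x, cdot (curl F x) (φ x) =
      (partialD 1 2 F x * φ x 0 - partialD 2 1 F x * φ x 0)
      + (partialD 2 0 F x * φ x 1 - partialD 0 2 F x * φ x 1)
      + (partialD 0 1 F x * φ x 2 - partialD 1 0 F x * φ x 2) := fun x => by
    simp [cdot, curl, Fin.sum_univ_three]; ring
  simp_rw [l, r]
  rw [integral_sub_add_sub_add_sub (A _ _ _) (A _ _ _) (A _ _ _) (A _ _ _) (A _ _ _) (A _ _ _),
    integral_sub_add_sub_add_sub (B _ _ _) (B _ _ _) (B _ _ _) (B _ _ _) (B _ _ _) (B _ _ _)]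
  simp only [E]
  ring

lemma IsTestFunction.curl_eq_zero {Ω : Set R3} {φ : R3 → C3} (h : IsTestFunction Ω φ) {x : R3}
    (hx : x ∉ Ω) : curl φ x = 0 := by
  have : fderiv ℝ φ x = 0 := by
    by_contra hne
    exact hx (h.2.2 (support_fderiv_subset ℝ hne))
  ext i
  fin_cases i <;> simp [curl, partialD, this]

lemma IsTestFunction.eq_zero {F : Type*} [NormedAddCommGroup F] [NormedSpace ℝ F]
    {Ω : Set R3} {φ : R3 → F} (h : IsTestFunction Ω φ) {x : R3}
    (hx : x ∉ Ω) : φ x = 0 := by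
  by_contra hne
  exact hx (h.2.2 (subset_tsupport _ hne))

/-- The restriction to a bounded open set `Ω` of a smooth field on `ℝ³`, with its classical curl,
as an element of `H(Ω; curl)`. -/
noncomputable def HCurl.ofSmooth {Ω : Set R3} (ho : IsOpen Ω) (hb : Bornology.IsBounded Ω) (F : R3 → C3)
    (hF : ContDiff ℝ (⊤ : ℕ∞) F) : HCurl Ω where
  val := F
  rot := curl F
  memLp_val := hF.continuous.memLp_restrict_of_isBounded hb ho.measurableSet 2
  memLp_rot := (continuous_curl hF).memLp_restrict_of_isBounded hb ho.measurableSet 2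
  weak_curl φ hφ := by
    rw [setIntegral_eq_integral_of_forall_compl_eq_zero fun x hx => by
        simp [hφ.curl_eq_zero hx, cdot],
      setIntegral_eq_integral_of_forall_compl_eq_zero fun x hx => by
        simp [hφ.eq_zero hx, cdot]]
    exact integral_cdot_curl hF hφ.1 hφ.2.1

/-- The difference of two elements of `H(Ω; curl)`. -/
noncomputable def HCurl.sub {Ω : Set R3} (ho : IsOpen Ω) (hb : Bornology.IsBounded Ω) (u v : HCurl Ω) :
    HCurl Ω where
  val := u.val - v.val
  rot := u.rot - v.rot
  memLp_val := u.memLp_val.sub v.memLp_val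
  memLp_rot := u.memLp_rot.sub v.memLp_rot
  weak_curl φ hφ := by
    have h1 := hφ.1.continuous.memLp_restrict_of_isBounded hb ho.measurableSet 2
    have h2 := (continuous_curl hφ.1).memLp_restrict_of_isBounded hb ho.measurableSet 2
    simp only [Pi.sub_apply, cdot_sub_left]
    rw [integral_sub (integrable_cdot u.memLp_val h2) (integrable_cdot v.memLp_val h2),
      integral_sub (integrable_cdot u.memLp_rot h1) (integrable_cdot v.memLp_rot h1),
      u.weak_curl φ hφ, v.weak_curl φ hφ]

lemma HCurl.trace_apply {Ω : Set R3} (ho : IsOpen Ω) (hb : Bornology.IsBounded Ω) (u : HCurl Ω)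
    (w : SmoothField) :
    u.trace w = (∫ x in Ω, cdot (u.val x) (curl w.1 x)) - ∫ x in Ω, cdot (u.rot x) (w.1 x) :=
  integral_sub
    (integrable_cdot u.memLp_val
      ((continuous_curl w.2).memLp_restrict_of_isBounded hb ho.measurableSet 2))
    (integrable_cdot u.memLp_rot
      (w.2.continuous.memLp_restrict_of_isBounded hb ho.measurableSet 2))

lemma HCurl.trace_sub {Ω : Set R3} (ho : IsOpen Ω) (hb : Bornology.IsBounded Ω) (u v : HCurl Ω) :
    (HCurl.sub ho hb u v).trace = u.trace - v.trace := by
  funext w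
  have h1 := w.2.continuous.memLp_restrict_of_isBounded hb ho.measurableSet 2
  have h2 := (continuous_curl w.2).memLp_restrict_of_isBounded hb ho.measurableSet 2
  rw [Pi.sub_apply, trace_apply ho hb, trace_apply ho hb, trace_apply ho hb]
  simp only [HCurl.sub, Pi.sub_apply, cdot_sub_left]
  rw [integral_sub (integrable_cdot u.memLp_val h2) (integrable_cdot v.memLp_val h2),
      integral_sub (integrable_cdot u.memLp_rot h1) (integrable_cdot v.memLp_rot h1)]
  ring

/-- The trace of `u` is bounded by the norm of `u`, uniformly over the smooth fields `w` for which
`w` and `curl w` have `L²` norm at most `B`. -/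
lemma HCurl.enorm_trace_le {Ω : Set R3} (ho : IsOpen Ω) (hb : Bornology.IsBounded Ω)
    (u : HCurl Ω) (w : SmoothField) {B : ℝ≥0∞}
    (h1 : eLpNorm w.1 2 (volume.restrict Ω) ≤ B)
    (h2 : eLpNorm (curl w.1) 2 (volume.restrict Ω) ≤ B) :
    ‖u.trace w‖ₑ ≤ u.norm * B := by
  have m1 := w.2.continuous.memLp_restrict_of_isBounded hb ho.measurableSet 2
  have m2 := (continuous_curl w.2).memLp_restrict_of_isBounded hb ho.measurableSet 2
  rw [trace_apply ho hb, HCurl.norm, add_mul]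
  refine (enorm_sub_le).trans (add_le_add ?_ ?_)
  · exact (enorm_integral_cdot_le u.memLp_val m2).trans (by gcongr)
  · exact (enorm_integral_cdot_le u.memLp_rot m1).trans (by gcongr)

lemma HCurl.enorm_trace_le_normTH {Ω : Set R3} (ho : IsOpen Ω) (hb : Bornology.IsBounded Ω)
    (u : HCurl Ω) (w : SmoothField) {B : ℝ≥0∞} (hB : B ≠ ∞)
    (h1 : eLpNorm w.1 2 (volume.restrict Ω) ≤ B)
    (h2 : eLpNorm (curl w.1) 2 (volume.restrict Ω) ≤ B) :
    ‖u.trace w‖ₑ ≤ normTH Ω u.trace * B := by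
  rcases eq_or_ne B 0 with rfl | h0
  · simpa using u.enorm_trace_le ho hb w h1 h2
  rw [← ENNReal.div_le_iff_le_mul (Or.inl h0) (Or.inl hB)]
  refine le_iInf₂ fun u' hu => ENNReal.div_le_of_le_mul ?_
  rw [← hu]
  exact u'.enorm_trace_le ho hb w h1 h2

/-! ### Complex plane waves -/

/-- The bilinear product `ζ · x` of a complex vector `ζ` and a real vector `x`. -/
noncomputable def phase (ζ : C3) (x : R3) : ℂ := ∑ j, ζ j * (x j : ℂ)

/-- The plane wave `x ↦ exp(i ζ · x) η` with complex wave vector `ζ` and polarisation `η`. -/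
noncomputable def planeWave (ζ η : C3) (x : R3) : C3 := Complex.exp (Complex.I * phase ζ x) • η

/-- The bilinear cross product on `ℂ³`. -/
noncomputable def cross3 (a b : C3) : C3 :=
  !₂[a 1 * b 2 - a 2 * b 1, a 2 * b 0 - a 0 * b 2, a 0 * b 1 - a 1 * b 0]

/-- The `L²(Ω)` norm of `x ↦ exp(i ζ · x)`. -/
noncomputable def expNorm (Ω : Set R3) (ζ : C3) : ℝ≥0∞ :=
  eLpNorm (fun x => Complex.exp (Complex.I * phase ζ x)) 2 (volume.restrict Ω)

lemma contDiff_phase (ζ : C3) : ContDiff ℝ (⊤ : ℕ∞) (phase ζ) := by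
  unfold phase
  refine ContDiff.sum fun j _ => contDiff_const.mul ?_
  exact Complex.ofRealCLM.contDiff.comp (EuclideanSpace.proj (𝕜 := ℝ) j).contDiff

lemma contDiff_exp_phase (ζ : C3) :
    ContDiff ℝ (⊤ : ℕ∞) fun x => Complex.exp (Complex.I * phase ζ x) :=
  (contDiff_const.mul (contDiff_phase ζ)).cexp

lemma contDiff_planeWave (ζ η : C3) : ContDiff ℝ (⊤ : ℕ∞) (planeWave ζ η) :=
  (contDiff_exp_phase ζ).smul contDiff_const

/-- The plane wave as a smooth field. -/
noncomputable def planeField (ζ η : C3) : SmoothField := ⟨planeWave ζ η, contDiff_planeWave ζ η⟩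

lemma phase_add_left (ζ ζ' : C3) (x : R3) : phase (ζ + ζ') x = phase ζ x + phase ζ' x := by
  simp [phase, add_mul, Finset.sum_add_distrib]

lemma phase_add_smul (ζ : C3) (x v : R3) (t : ℝ) :
    phase ζ (x + t • v) = phase ζ x + t * phase ζ v := by
  simp [phase, Fin.sum_univ_three]; ring

lemma partialD_planeWave (ζ η : C3) (i j : Fin 3) (x : R3) :
    partialD i j (planeWave ζ η) x =
      Complex.I * ζ i * Complex.exp (Complex.I * phase ζ x) * η j := by
  have hd : DifferentiableAt ℝ (planeWave ζ η) x :=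
    ((contDiff_planeWave ζ η).differentiable (by simp)) x
  rw [partialD_eq hd]
  have hd' : DifferentiableAt ℝ (fun y => planeWave ζ η y j) x :=
    ((EuclideanSpace.proj j : C3 →L[ℂ] ℂ).restrictScalars ℝ).differentiableAt.comp x hd
  rw [← hd'.lineDeriv_eq_fderiv]
  have hp : phase ζ (EuclideanSpace.single i (1 : ℝ)) = ζ i := by
    fin_cases i <;> simp [phase, Fin.sum_univ_three]
  refine HasDerivAt.deriv ?_
  have e : (fun t : ℝ => planeWave ζ η (x + t • EuclideanSpace.single i (1 : ℝ)) j) =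
      fun t : ℝ => Complex.exp (Complex.I * (phase ζ x + t * ζ i)) * η j := by
    funext t
    rw [planeWave, phase_add_smul, hp]
    simp
  rw [e]
  have h1 : HasDerivAt (fun t : ℝ => Complex.I * (phase ζ x + t * ζ i)) (Complex.I * ζ i) 0 := by
    simpa using ((((hasDerivAt_id (0 : ℝ)).ofReal_comp.mul_const (ζ i)).const_add
      (phase ζ x)).const_mul Complex.I)
  refine (h1.cexp.mul_const (η j)).congr_deriv ?_
  rw [Complex.ofReal_zero, zero_mul, add_zero]
  ring

lemma curl_planeWave (ζ η : C3) :
    curl (planeWave ζ η) = planeWave ζ (Complex.I • cross3 ζ η) := by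
  funext x
  ext i
  simp only [curl, partialD_planeWave]
  fin_cases i <;> simp [planeWave, cross3] <;> ring

lemma cross3_smul (c : ℂ) (ζ η : C3) : cross3 ζ (c • η) = c • cross3 ζ η := by
  ext i
  fin_cases i <;> simp [cross3] <;> ring

lemma cross3_cross3_self (ζ η : C3) :
    cross3 ζ (cross3 ζ η) = cdot ζ η • ζ - cdot ζ ζ • η := by
  ext i
  fin_cases i <;> simp [cross3, cdot, Fin.sum_univ_three] <;> ring

lemma planeWave_smul (c : ℂ) (ζ η : C3) : planeWave ζ (c • η) = c • planeWave ζ η := by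
  funext x
  exact smul_comm _ _ _

lemma curl_curl_planeWave {ζ η : C3} (h : cdot ζ η = 0) :
    curl (planeWave ζ (Complex.I • cross3 ζ η)) = cdot ζ ζ • planeWave ζ η := by
  rw [curl_planeWave, cross3_smul, cross3_cross3_self, h, smul_smul, Complex.I_mul_I, zero_smul,
    zero_sub, smul_neg, neg_smul, neg_neg, one_smul, planeWave_smul]

lemma cdot_planeWave (ζ η ζ' η' : C3) (x : R3) :
    cdot (planeWave ζ η x) (planeWave ζ' η' x) =
      Complex.exp (Complex.I * phase (ζ + ζ') x) * cdot η η' := by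
  rw [planeWave, planeWave, cdot_smul_left, cdot_smul_right, phase_add_left, mul_add,
    Complex.exp_add]
  ring

lemma eLpNorm_planeWave (Ω : Set R3) (ζ η : C3) :
    eLpNorm (planeWave ζ η) 2 (volume.restrict Ω) = ‖η‖ₑ * expNorm Ω ζ := by
  have : ∀ x, ‖planeWave ζ η x‖ₑ = ‖(‖η‖ : ℂ) * Complex.exp (Complex.I * phase ζ x)‖ₑ := fun x => by
    rw [planeWave, enorm_smul, enorm_mul, mul_comm, ← ofReal_norm (‖η‖ : ℂ),
      Complex.norm_real, norm_norm, ofReal_norm]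
  rw [eLpNorm_congr_enorm_ae (Filter.Eventually.of_forall this)]
  have h := eLpNorm_const_smul (‖η‖ : ℂ) (fun x => Complex.exp (Complex.I * phase ζ x)) 2
    (volume.restrict Ω)
  rw [← ofReal_norm (‖η‖ : ℂ), Complex.norm_real, norm_norm, ofReal_norm] at h
  exact h

/-! ### The boundary map tested against plane waves -/

section Maxwell

variable {Ω : Set R3} {ω ε₀ μ₀ : ℝ}

/-- Green's identity behind the linearised problem: if `(E₁, H₁)` solves the Maxwell system with
source `J` and `E₁ × ν = 0`, then the trace of `H₁` tested against a smooth solution `w` of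
`curl curl w = k² w` is `- ∫ J · w`. -/
lemma trace_eq_neg_integral (ho : IsOpen Ω) (hb : Bornology.IsBounded Ω) (hω : ω ≠ 0) (hμ₀ : μ₀ ≠ 0) {J : R3 → C3} {E₁ H₁ : HCurl Ω}
    (h : SolvesMaxwell ω ε₀ μ₀ J E₁ H₁) (h0 : E₁.trace = 0) {w w' : SmoothField}
    (hc : curl w.1 = w'.1) (hc' : curl w'.1 = ((ω ^ 2 * ε₀ * μ₀ : ℝ) : ℂ) • w.1) :
    H₁.trace w = - ∫ x in Ω, cdot (J x) (w.1 x) := by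
  have m1 := w.2.continuous.memLp_restrict_of_isBounded hb ho.measurableSet 2
  have m2 := w'.2.continuous.memLp_restrict_of_isBounded hb ho.measurableSet 2
  have hωc : (ω : ℂ) ≠ 0 := by exact_mod_cast hω
  have hμc : (μ₀ : ℂ) ≠ 0 := by exact_mod_cast hμ₀
  have hne : Complex.I * ω * μ₀ ≠ 0 := by simp [hωc, hμc]
  have e0 : ∫ x in Ω, cdot (E₁.rot x) (w'.1 x) =
      ((ω ^ 2 * ε₀ * μ₀ : ℝ) : ℂ) * ∫ x in Ω, cdot (E₁.val x) (w.1 x) := by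
    have := congrFun h0 w'
    rw [HCurl.trace_apply ho hb] at this
    simp only [hc', Pi.smul_apply, cdot_smul_right, integral_const_mul, Pi.zero_apply] at this
    exact (sub_eq_zero.1 this).symm
  have e1 : ∫ x in Ω, cdot (E₁.rot x) (w'.1 x) =
      (Complex.I * ω * μ₀) * ∫ x in Ω, cdot (H₁.val x) (w'.1 x) := by
    rw [← integral_const_mul]
    refine integral_congr_ae ?_
    filter_upwards [h.1] with x hx
    rw [sub_eq_zero.1 hx, cdot_smul_left]
  have e2 : ∫ x in Ω, cdot (J x) (w.1 x) = (∫ x in Ω, cdot (H₁.rot x) (w.1 x)) +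
      (Complex.I * ω * ε₀) * ∫ x in Ω, cdot (E₁.val x) (w.1 x) := by
    rw [← integral_const_mul, ← integral_add (integrable_cdot H₁.memLp_rot m1)
      ((integrable_cdot E₁.memLp_val m1).const_mul _)]
    refine integral_congr_ae ?_
    filter_upwards [h.2] with x hx
    rw [← hx, cdot_add_left, cdot_smul_left]
  have e3 : ∫ x in Ω, cdot (H₁.val x) (w'.1 x) =
      - (Complex.I * ω * ε₀) * ∫ x in Ω, cdot (E₁.val x) (w.1 x) := by
    apply mul_left_cancel₀ hne
    rw [← e1, e0]
    push_cast
    linear_combination (ω ^ 2 * ε₀ * μ₀ * ∫ x in Ω, cdot (E₁.val x) (w.1 x)) * Complex.I_sq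
  rw [HCurl.trace_apply ho hb, e2, hc, e3]
  ring

/-- When `ω` is not an eigenvalue, solutions of the unperturbed system with the same tangential
trace of the electric field have the same electric field. -/
lemma val_ae_eq_of_trace_eq (ho : IsOpen Ω) (hb : Bornology.IsBounded Ω) 
    (hω : ¬ IsMaxwellEigenvalue Ω ω ε₀ μ₀) {E H E' H' : HCurl Ω}
    (h : SolvesMaxwell ω ε₀ μ₀ 0 E H) (h' : SolvesMaxwell ω ε₀ μ₀ 0 E' H')
    (ht : E.trace = E'.trace) : E.val =ᵐ[volume.restrict Ω] E'.val := by
  by_contra hne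
  refine hω ⟨HCurl.sub ho hb E E', HCurl.sub ho hb H H', ⟨?_, ?_⟩, ?_, fun hz => hne ?_⟩
  · filter_upwards [h.1, h'.1] with x hx hx'
    simp only [HCurl.sub, Pi.sub_apply, smul_sub]
    rw [sub_sub_sub_comm, hx, hx', sub_zero]
  · filter_upwards [h.2, h'.2] with x hx hx'
    simp only [HCurl.sub, Pi.sub_apply, smul_sub]
    rw [sub_add_sub_comm, hx, hx']
    simp
  · rw [HCurl.trace_sub, ht, sub_self]
  · filter_upwards [hz.1] with x hx
    simpa [HCurl.sub, sub_eq_zero] using hx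

/-- Plane waves are electric fields of solutions of the unperturbed system. -/
lemma solvesMaxwell_planeWave (ho : IsOpen Ω) (hb : Bornology.IsBounded Ω) 
    (hω : ω ≠ 0) (hμ₀ : μ₀ ≠ 0) {ζ η : C3} (hη : cdot ζ η = 0)
    (hζ : cdot ζ ζ = ((ω ^ 2 * ε₀ * μ₀ : ℝ) : ℂ)) :
    SolvesMaxwell ω ε₀ μ₀ 0 (HCurl.ofSmooth ho hb _ (contDiff_planeWave ζ η))
      (HCurl.ofSmooth ho hb _ (contDiff_planeWave ζ
        ((Complex.I * ω * μ₀)⁻¹ • Complex.I • cross3 ζ η))) := by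
  have hωc : (ω : ℂ) ≠ 0 := by exact_mod_cast hω
  have hμc : (μ₀ : ℂ) ≠ 0 := by exact_mod_cast hμ₀
  have hne : Complex.I * ω * μ₀ ≠ 0 := by simp [hωc, hμc]
  refine ⟨Filter.Eventually.of_forall fun x => ?_, Filter.Eventually.of_forall fun x => ?_⟩
  · simp only [HCurl.ofSmooth]
    rw [curl_planeWave, planeWave_smul _ _ (Complex.I • cross3 ζ η), Pi.smul_apply,
      smul_inv_smul₀ hne, sub_self]
  · simp only [HCurl.ofSmooth]
    have : curl (planeWave ζ ((Complex.I * ω * μ₀)⁻¹ • Complex.I • cross3 ζ η)) =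
        (-(Complex.I * ω * ε₀)) • planeWave ζ η := by
      rw [curl_planeWave, cross3_smul, smul_comm, planeWave_smul, ← curl_planeWave,
        curl_curl_planeWave hη, hζ, smul_smul]
      congr 1
      rw [inv_mul_eq_iff_eq_mul₀ hne]
      push_cast
      linear_combination (ω ^ 2 * ε₀ * μ₀ : ℂ) * Complex.I_sq
    rw [this]
    simp

/-- The basic estimate: an exponential `exp(i (ζ + ζ') · x)` that is the product of two plane waves
of wave number `k` is tested against `σ` through the linearised boundary map. -/
lemma enorm_integral_exp_le (ho : IsOpen Ω) (hb : Bornology.IsBounded Ω) 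
    (hω : ω ≠ 0) (hμ₀ : μ₀ ≠ 0) (hne : ¬ IsMaxwellEigenvalue Ω ω ε₀ μ₀)
    {k : ℝ} (hk : k ^ 2 = ω ^ 2 * ε₀ * μ₀) (hk1 : 1 ≤ k) {σ : R3 → ℝ} {C : ℝ≥0∞}
    (hC : ∀ g ∈ TH Ω, ∃ h, LinearisedMap Ω ω ε₀ μ₀ σ g h ∧ normTH Ω h ≤ C * normTH Ω g)
    {ζ η ζ' η' : C3} (hζ : cdot ζ ζ = (k : ℂ) ^ 2) (hζ' : cdot ζ' ζ' = (k : ℂ) ^ 2)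
    (h : cdot ζ η = 0) (h' : cdot ζ' η' = 0) (hηη' : cdot η η' = 1)
    (hη : ‖η‖ ≤ 1) (hη' : ‖η'‖ ≤ 1) (hc : ‖cross3 ζ η‖ ≤ k) (hc' : ‖cross3 ζ' η'‖ ≤ k) :
    ‖∫ x in Ω, (σ x : ℂ) * Complex.exp (Complex.I * phase (ζ + ζ') x)‖ₑ ≤
      C * (ENNReal.ofReal ((1 + k) * k) * (expNorm Ω ζ * expNorm Ω ζ')) := by
  have hk' : (k : ℂ) ^ 2 = ((ω ^ 2 * ε₀ * μ₀ : ℝ) : ℂ) := by rw [← hk]; push_cast; rfl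
  rw [hk'] at hζ hζ'
  have hen : ∀ {v : C3} {a : ℝ}, ‖v‖ ≤ a → ‖v‖ₑ ≤ ENNReal.ofReal a := fun hv => by
    rw [← ofReal_norm]; exact ENNReal.ofReal_le_ofReal hv
  have hI : ∀ v : C3, ‖Complex.I • v‖ₑ = ‖v‖ₑ := fun v => by
    rw [enorm_smul, ← ofReal_norm Complex.I, Complex.norm_I, ENNReal.ofReal_one, one_mul]
  obtain ⟨P, hP⟩ : ∃ P, P = HCurl.ofSmooth ho hb _ (contDiff_planeWave ζ η) := ⟨_, rfl⟩
  obtain ⟨g, ⟨E₀, H₀, E₁, H₁, h00, ht0, h1, ht1, rfl⟩, hle⟩ := hC P.trace ⟨P, rfl⟩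
  have hE₀ : E₀.val =ᵐ[volume.restrict Ω] planeWave ζ η :=
    val_ae_eq_of_trace_eq ho hb hne h00 (solvesMaxwell_planeWave ho hb hω hμ₀ h hζ)
      (ht0.trans (by rw [hP]))
  have hPn : P.norm ≤ ENNReal.ofReal (1 + k) * expNorm Ω ζ := by
    rw [hP, HCurl.norm, ENNReal.ofReal_add zero_le_one (by linarith), add_mul]
    refine add_le_add ?_ ?_
    · exact (eLpNorm_planeWave Ω ζ η).le.trans (by gcongr; exact hen hη)
    · simp only [HCurl.ofSmooth, curl_planeWave]
      rw [eLpNorm_planeWave, hI]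
      gcongr
      exact hen hc
  have hPt : normTH Ω P.trace ≤ P.norm :=
    iInf₂_le (f := fun (u : HCurl Ω) (_ : u.trace = P.trace) => u.norm) P rfl
  have hw1 : eLpNorm (planeWave ζ' η') 2 (volume.restrict Ω) ≤
      ENNReal.ofReal k * expNorm Ω ζ' := by
    rw [eLpNorm_planeWave]; gcongr; exact hen (hη'.trans hk1)
  have hw2 : eLpNorm (curl (planeWave ζ' η')) 2 (volume.restrict Ω) ≤
      ENNReal.ofReal k * expNorm Ω ζ' := by
    rw [curl_planeWave, eLpNorm_planeWave, hI]; gcongr; exact hen hc'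
  have key : ‖∫ x in Ω, (σ x : ℂ) * Complex.exp (Complex.I * phase (ζ + ζ') x)‖ₑ =
      ‖H₁.trace (planeField ζ' η')‖ₑ := by
    rw [trace_eq_neg_integral ho hb hω hμ₀ h1 ht1 (w := planeField ζ' η')
      (w' := planeField ζ' (Complex.I • cross3 ζ' η')) (curl_planeWave ζ' η')
      ((curl_curl_planeWave h').trans (by rw [hζ']; rfl)), enorm_neg]
    congr 1
    refine integral_congr_ae ?_
    filter_upwards [hE₀] with x hx
    rw [cdot_smul_left, hx, planeField, cdot_planeWave, hηη', mul_one]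
  rw [key]
  calc ‖H₁.trace (planeField ζ' η')‖ₑ
      ≤ normTH Ω H₁.trace * (ENNReal.ofReal k * expNorm Ω ζ') := by
        have hfin : ENNReal.ofReal k * expNorm Ω ζ' ≠ ∞ :=
          ENNReal.mul_ne_top ENNReal.ofReal_ne_top
            ((contDiff_exp_phase ζ').continuous.memLp_restrict_of_isBounded hb
              ho.measurableSet 2).2.ne
        exact H₁.enorm_trace_le_normTH ho hb (planeField ζ' η') hfin hw1 hw2
    _ ≤ (C * (ENNReal.ofReal (1 + k) * expNorm Ω ζ)) * (ENNReal.ofReal k * expNorm Ω ζ') := by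
        gcongr
        refine hle.trans ?_
        gcongr
        exact hPt.trans hPn
    _ = _ := by
        rw [ENNReal.ofReal_mul (by linarith)]
        ring

end Maxwell

/-! ### Slicing a domain by parallel planes -/

lemma iSup_volume_projection_lt_top {Ω : Set R3} (hb : Bornology.IsBounded Ω) :
    (⨆ (K : Submodule ℝ R3) (_ : Module.finrank ℝ K = 2),
      volume ((fun x : R3 => K.orthogonalProjectionOnto x) '' Ω)) < ∞ := by
  obtain ⟨R, hR⟩ := hb.subset_ball 0
  refine lt_of_le_of_lt (b := volume (Metric.ball (0 : EuclideanSpace ℝ (Fin 2)) R)) ?_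
    measure_ball_lt_top
  refine iSup₂_le fun K hK => ?_
  have e : K ≃ₗᵢ[ℝ] EuclideanSpace ℝ (Fin 2) :=
    ((stdOrthonormalBasis ℝ K).reindex (finCongr hK)).repr
  rw [← e.measurePreserving.measure_preimage measurableSet_ball.nullMeasurableSet]
  refine measure_mono ?_
  rintro _ ⟨x, hx, rfl⟩
  have := hR hx
  simp only [Set.mem_preimage, mem_ball_zero_iff, LinearIsometryEquiv.norm_map] at this ⊢
  exact (K.norm_orthogonalProjectionOnto_apply_le x).trans_lt this

lemma measurePreserving_inner_prod_projection {v : R3} (hv : ‖v‖ = 1) :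
    MeasurePreserving (fun x : R3 => ((inner ℝ v x : ℝ),
      (ℝ ∙ v)ᗮ.orthogonalProjectionOnto x)) := by
  have h1 := (ℝ ∙ v).orthogonalDecomposition.measurePreserving
  have h2 := WithLp.volume_preserving_ofLp (ℝ ∙ v) (ℝ ∙ v)ᗮ
  have h3 : MeasurePreserving (Prod.map (LinearIsometryEquiv.toSpanUnitSingleton (𝕜 := ℝ) v hv).symm
      (id : (ℝ ∙ v)ᗮ → (ℝ ∙ v)ᗮ)) :=
    (LinearIsometryEquiv.toSpanUnitSingleton (𝕜 := ℝ) v hv).symm.measurePreserving.prod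
      (MeasurePreserving.id volume)
  convert (h3.comp h2).comp h1 using 1
  funext x
  simp only [Function.comp_apply, Submodule.orthogonalDecomposition_apply, Prod.map_apply, id_eq,
    Prod.mk.injEq, and_true]
  rw [LinearIsometryEquiv.eq_symm_apply]
  ext1
  rw [LinearIsometryEquiv.toSpanUnitSingleton_apply]
  simp [Submodule.starProjection_unit_singleton ℝ hv]

lemma exists_inner_mem_Icc {Ω : Set R3} (hb : Bornology.IsBounded Ω) (hne : Ω.Nonempty) {v : R3}
    (hv : ‖v‖ = 1) : ∃ a : ℝ, ∀ x ∈ Ω, (inner ℝ v x : ℝ) ∈ Set.Icc a (a + Metric.diam Ω) := by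
  have hd : ∀ x ∈ Ω, ∀ y ∈ Ω, (inner ℝ v x : ℝ) - Metric.diam Ω ≤ inner ℝ v y := by
    intro x hx y hy
    have h1 : (inner ℝ v (x - y) : ℝ) ≤ ‖v‖ * ‖x - y‖ := real_inner_le_norm _ _
    rw [inner_sub_right, hv, one_mul, ← dist_eq_norm] at h1
    linarith [Metric.dist_le_diam_of_mem hb hx hy]
  obtain ⟨x₀, hx₀⟩ := hne
  have hbdd : BddBelow ((fun x => (inner ℝ v x : ℝ)) '' Ω) :=
    ⟨_, by rintro _ ⟨y, hy, rfl⟩; exact hd x₀ hx₀ y hy⟩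
  refine ⟨sInf ((fun x => (inner ℝ v x : ℝ)) '' Ω), fun x hx => ⟨csInf_le hbdd ⟨x, hx, rfl⟩, ?_⟩⟩
  have : (inner ℝ v x : ℝ) - Metric.diam Ω ≤ sInf ((fun x => (inner ℝ v x : ℝ)) '' Ω) :=
    le_csInf ⟨_, x₀, hx₀, rfl⟩ (by rintro _ ⟨y, hy, rfl⟩; exact hd x hx y hy)
  linarith

/-- The slices of `Ω` orthogonal to `v` are no larger than the projection of `Ω` along `v`, so that
functions of `v · x` integrate over `Ω` to at most `Vol₂(Ω)` times a one-dimensional integral. -/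
lemma lintegral_inner_le {Ω : Set R3} (hb : Bornology.IsBounded Ω) {v : R3}
    (hv : ‖v‖ = 1) {S : Set ℝ} (hS : MeasurableSet S) (hΩS : ∀ x ∈ Ω, (inner ℝ v x : ℝ) ∈ S)
    (ho : MeasurableSet Ω) {g : ℝ → ℝ≥0∞} (hg : Measurable g) :
    ∫⁻ x in Ω, g (inner ℝ v x) ≤ ENNReal.ofReal (vol2 Ω) * ∫⁻ s in S, g s := by
  set K : Submodule ℝ R3 := (ℝ ∙ v)ᗮ with hK
  have hv0 : v ≠ 0 := by rintro rfl; simp at hv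
  have hf : Module.finrank ℝ K = 2 := by
    have : Fact (Module.finrank ℝ R3 = 2 + 1) := ⟨by simp⟩
    exact Submodule.finrank_orthogonal_span_singleton hv0
  set P : Set K := toMeasurable volume ((fun x : R3 => K.orthogonalProjectionOnto x) '' Ω) with hP
  have hPm : MeasurableSet P := measurableSet_toMeasurable _ _
  have hPv : volume P ≤ ENNReal.ofReal (vol2 Ω) := by
    rw [vol2, ENNReal.ofReal_toReal (iSup_volume_projection_lt_top hb).ne, hP,
      measure_toMeasurable]
    exact le_iSup₂ (f := fun (K : Submodule ℝ R3) (_ : Module.finrank ℝ K = 2) =>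
      volume ((fun x : R3 => K.orthogonalProjectionOnto x) '' Ω)) K hf
  have hmp := measurePreserving_inner_prod_projection hv
  have hgS : Measurable (S.indicator g) := hg.indicator hS
  have h1P : Measurable (P.indicator (1 : K → ℝ≥0∞)) := measurable_one.indicator hPm
  calc ∫⁻ x in Ω, g (inner ℝ v x)
      ≤ ∫⁻ x, S.indicator g (inner ℝ v x) *
          P.indicator (1 : K → ℝ≥0∞) (K.orthogonalProjectionOnto x) := by
        rw [← lintegral_indicator ho]
        refine lintegral_mono fun x => ?_
        by_cases hx : x ∈ Ω
        · have hxP : K.orthogonalProjectionOnto x ∈ P := subset_toMeasurable _ _ ⟨x, hx, rfl⟩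
          simp [hx, hΩS x hx, hxP]
        · simp [hx]
    _ = ∫⁻ p : ℝ × K, S.indicator g p.1 * P.indicator (1 : K → ℝ≥0∞) p.2 :=
        hmp.lintegral_comp (f := fun p : ℝ × K => S.indicator g p.1 *
          P.indicator (1 : K → ℝ≥0∞) p.2) (by fun_prop)
    _ = (∫⁻ s in S, g s) * volume P := by
        rw [Measure.volume_eq_prod, lintegral_prod_mul hgS.aemeasurable h1P.aemeasurable,
          lintegral_indicator hS, lintegral_indicator_one hPm]
    _ ≤ _ := by rw [mul_comm]; gcongr

/-- The product of the integrals of `exp(-2 τ v · x)` and `exp(2 τ v · x)` over `Ω`. -/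
lemma lintegral_exp_inner_le {Ω : Set R3} (ho : IsOpen Ω) (hb : Bornology.IsBounded Ω)
    (hne : Ω.Nonempty) {v : R3} (hv : ‖v‖ = 1) {τ : ℝ} (hτ : 0 < τ) :
    (∫⁻ x in Ω, ENNReal.ofReal (Real.exp (-(2 * τ * inner ℝ v x)))) *
      (∫⁻ x in Ω, ENNReal.ofReal (Real.exp (2 * τ * inner ℝ v x))) ≤
    ENNReal.ofReal (vol2 Ω ^ 2 * (Real.exp (2 * τ * Metric.diam Ω) *
      (1 - Real.exp (-(2 * τ * Metric.diam Ω))) ^ 2 / (2 * τ) ^ 2)) := by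
  obtain ⟨a, ha⟩ := exists_inner_mem_Icc hb hne hv
  have hD : 0 ≤ Metric.diam Ω := Metric.diam_nonneg
  set D := Metric.diam Ω
  have hV : 0 ≤ vol2 Ω := ENNReal.toReal_nonneg
  have key : ∀ c : ℝ, c ≠ 0 → ∫⁻ x in Ω, ENNReal.ofReal (Real.exp (c * inner ℝ v x)) ≤
      ENNReal.ofReal (vol2 Ω * ((Real.exp (c * (a + D)) - Real.exp (c * a)) / c)) := by
    intro c hc
    refine (lintegral_inner_le hb hv measurableSet_Icc ha ho.measurableSet
      (g := fun s => ENNReal.ofReal (Real.exp (c * s))) (by fun_prop)).trans ?_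
    rw [ENNReal.ofReal_mul hV]
    gcongr
    have hint : IntegrableOn (fun s => Real.exp (c * s)) (Set.Icc a (a + D)) :=
      (by fun_prop : Continuous fun s => Real.exp (c * s)).integrableOn_Icc
    rw [← ofReal_integral_eq_lintegral_ofReal hint
      (Filter.Eventually.of_forall fun s => (Real.exp_pos _).le), integral_Icc_eq_integral_Ioc,
      ← intervalIntegral.integral_of_le (by linarith)]
    refine ENNReal.ofReal_le_ofReal (le_of_eq ?_)
    rw [intervalIntegral.integral_comp_mul_left _ hc, integral_exp, smul_eq_mul, inv_mul_eq_div]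
  have k1 := key (-(2 * τ)) (by linarith)
  have k2 := key (2 * τ) (by linarith)
  simp only [neg_mul] at k1
  refine (mul_le_mul' k1 k2).trans ?_
  have h1 : 0 ≤ (Real.exp (-(2 * τ * (a + D))) - Real.exp (-(2 * τ * a))) / -(2 * τ) := by
    rw [← neg_div_neg_eq]
    refine div_nonneg ?_ (by linarith)
    have : Real.exp (-(2 * τ * (a + D))) ≤ Real.exp (-(2 * τ * a)) :=
      Real.exp_le_exp.2 (by nlinarith)
    linarith
  rw [← ENNReal.ofReal_mul (mul_nonneg hV h1)]
  refine ENNReal.ofReal_le_ofReal (le_of_eq ?_)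
  have e1 : Real.exp (-(2 * τ * (a + D))) = (Real.exp (2 * τ * a))⁻¹ * (Real.exp (2 * τ * D))⁻¹ := by
    rw [← Real.exp_neg, ← Real.exp_neg, ← Real.exp_add]; ring_nf
  have e2 : Real.exp (2 * τ * (a + D)) = Real.exp (2 * τ * a) * Real.exp (2 * τ * D) := by
    rw [← Real.exp_add]; ring_nf
  rw [e1, e2, Real.exp_neg, Real.exp_neg]
  have := (Real.exp_pos (2 * τ * a)).ne'
  have := (Real.exp_pos (2 * τ * D)).ne'
  field_simp
  ring

/-! ### The choice of wave vectors and polarisations -/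

/-- A real vector, seen as a complex one. -/
noncomputable def toC (v : R3) : C3 := WithLp.toLp 2 fun i => (v i : ℂ)

@[simp] lemma toC_apply (v : R3) (i : Fin 3) : toC v i = (v i : ℂ) := rfl

lemma phase_toC (v x : R3) : phase (toC v) x = ((inner ℝ v x : ℝ) : ℂ) := by
  simp [phase, PiLp.inner_apply, Fin.sum_univ_three, mul_comm]

lemma phase_smul (c : ℂ) (ζ : C3) (x : R3) : phase (c • ζ) x = c * phase ζ x := by
  simp [phase, Fin.sum_univ_three]; ring

lemma norm_sq_eq_sum (v : R3) : v 0 ^ 2 + v 1 ^ 2 + v 2 ^ 2 = ‖v‖ ^ 2 := by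
  simp [EuclideanSpace.norm_sq_eq, Fin.sum_univ_three]

lemma inner_eq_sum (v w : R3) : v 0 * w 0 + v 1 * w 1 + v 2 * w 2 = inner ℝ v w := by
  simp [PiLp.inner_apply, Fin.sum_univ_three, mul_comm]

lemma norm_sq_toC_add (p q : R3) (z w : ℂ) (h : inner ℝ p q = (0 : ℝ)) :
    ‖z • toC p + w • toC q‖ ^ 2 = ‖z‖ ^ 2 * ‖p‖ ^ 2 + ‖w‖ ^ 2 * ‖q‖ ^ 2 := by
  have h1 := inner_eq_sum p q
  rw [h] at h1
  rw [← norm_sq_eq_sum, ← norm_sq_eq_sum, EuclideanSpace.norm_sq_eq, Fin.sum_univ_three]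
  simp only [← Complex.normSq_eq_norm_sq, Complex.normSq_apply]
  simp
  linear_combination (2 * z.re * w.re + 2 * z.im * w.im) * h1

lemma norm_toC (v : R3) : ‖toC v‖ = ‖v‖ := by
  simp [EuclideanSpace.norm_eq]

lemma cdot_toC (p q : R3) : cdot (toC p) (toC q) = ((inner ℝ p q : ℝ) : ℂ) := by
  rw [← inner_eq_sum]; simp [cdot, Fin.sum_univ_three]

/-- The cross product of real vectors. -/
noncomputable def crossR (a b : R3) : R3 :=
  !₂[a 1 * b 2 - a 2 * b 1, a 2 * b 0 - a 0 * b 2, a 0 * b 1 - a 1 * b 0]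

lemma toC_crossR (a b : R3) : toC (crossR a b) = cross3 (toC a) (toC b) := by
  ext i; fin_cases i <;> simp [crossR, cross3]

lemma norm_sq_crossR (a b : R3) :
    ‖crossR a b‖ ^ 2 = ‖a‖ ^ 2 * ‖b‖ ^ 2 - (inner ℝ a b : ℝ) ^ 2 := by
  rw [← norm_sq_eq_sum, ← norm_sq_eq_sum, ← norm_sq_eq_sum, ← inner_eq_sum]
  simp [crossR]; ring

lemma inner_crossR_left (a b : R3) : inner ℝ a (crossR a b) = (0 : ℝ) := by
  rw [← inner_eq_sum]; simp [crossR]; ring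

lemma inner_crossR_right (a b : R3) : inner ℝ b (crossR a b) = (0 : ℝ) := by
  rw [← inner_eq_sum]; simp [crossR]; ring

lemma cdot_add_right (u v w : C3) : cdot u (v + w) = cdot u v + cdot u w := by
  rw [cdot_comm, cdot_add_left, cdot_comm v, cdot_comm w]

lemma exists_unit_orthogonal (v : R3) : ∃ w : R3, ‖w‖ = 1 ∧ inner ℝ v w = (0 : ℝ) := by
  by_cases h : v 0 = 0 ∧ v 1 = 0
  · refine ⟨EuclideanSpace.single 0 1, by simp, ?_⟩
    rw [← inner_eq_sum]; simp [h.1]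
  · set u : R3 := !₂[- v 1, v 0, 0] with hu
    have hne : u ≠ 0 := by
      intro h0
      apply h
      have h1 := congrArg (fun x : R3 => x 0) h0
      have h2 := congrArg (fun x : R3 => x 1) h0
      simp [hu] at h1 h2
      exact ⟨h2, h1⟩
    refine ⟨‖u‖⁻¹ • u, norm_smul_inv_norm hne, ?_⟩
    rw [inner_smul_right, ← inner_eq_sum]
    simp [hu]
    right; ring

/-- An orthonormal pair adapted to a frequency `w`. The sign makes `2 π ‖w‖ f₁` the wave vector
`-2 π w` that occurs in the Fourier transform at `w`. -/
lemma exists_frame (w : R3) :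
    ∃ f₁ f₂ : R3, ‖f₁‖ = 1 ∧ ‖f₂‖ = 1 ∧ inner ℝ f₁ f₂ = (0 : ℝ) ∧ w = -(‖w‖ • f₁) := by
  obtain ⟨f₁, h₁, hw⟩ : ∃ f₁ : R3, ‖f₁‖ = 1 ∧ w = -(‖w‖ • f₁) := by
    rcases eq_or_ne w 0 with rfl | hw
    · exact ⟨EuclideanSpace.single 0 1, by simp, by simp⟩
    · refine ⟨-(‖w‖⁻¹ • w), by rw [norm_neg]; exact norm_smul_inv_norm hw, ?_⟩
      rw [smul_neg, neg_neg, smul_inv_smul₀ (norm_ne_zero_iff.2 hw)]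
  obtain ⟨f₂, h₂, h₁₂⟩ := exists_unit_orthogonal f₁
  exact ⟨f₁, f₂, h₁, h₂, h₁₂, hw⟩

lemma cdot_combination {f₁ f₂ : R3} (h₁ : ‖f₁‖ = 1) (h₂ : ‖f₂‖ = 1)
    (h₁₂ : inner ℝ f₁ f₂ = (0 : ℝ)) (a b c d : ℂ) :
    cdot (a • toC f₁ + b • toC f₂) (c • toC f₁ + d • toC f₂) = a * c + b * d := by
  simp only [cdot_add_left, cdot_add_right, cdot_smul_left, cdot_smul_right, cdot_toC,
    real_inner_comm f₁ f₂, h₁₂, real_inner_self_eq_norm_sq, h₁, h₂]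
  push_cast; ring

lemma cross3_combination (u v : C3) (a b c d : ℂ) :
    cross3 (a • u + b • v) (c • u + d • v) = (a * d - b * c) • cross3 u v := by
  ext i
  fin_cases i <;> simp [cross3] <;> ring

lemma expNorm_eq (Ω : Set R3) (ζ : C3) :
    expNorm Ω ζ = (∫⁻ x in Ω, ENNReal.ofReal (Real.exp (-(2 * (phase ζ x).im)))) ^ (1 / 2 : ℝ) := by
  rw [expNorm, eLpNorm_eq_lintegral_rpow_enorm_toReal (by simp) (by simp)]
  simp only [ENNReal.toReal_ofNat]
  congr 1
  refine lintegral_congr fun x => ?_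
  rw [← ofReal_norm, ENNReal.ofReal_rpow_of_nonneg (norm_nonneg _) zero_le_two,
    Complex.norm_exp, ← Real.exp_mul]
  simp
  ring_nf

/-- The Fourier transform at `w` of the extension of `σ` by zero outside `Ω`. -/
noncomputable def domainFourier (Ω : Set R3) (σ : R3 → ℝ) (w : R3) : ℂ :=
  ∫ x in Ω, (σ x : ℂ) * Complex.exp (Complex.I * ((-(2 * Real.pi * inner ℝ w x) : ℝ) : ℂ))

lemma domainFourier_eq {Ω : Set R3} {σ : R3 → ℝ} {w f₁ : R3} (hw : w = -(‖w‖ • f₁)) {ζ : C3}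
    (hζ : ζ = ((2 * Real.pi * ‖w‖ : ℝ) : ℂ) • toC f₁) :
    domainFourier Ω σ w = ∫ x in Ω, (σ x : ℂ) * Complex.exp (Complex.I * phase ζ x) := by
  rw [domainFourier]
  refine integral_congr_ae (Filter.Eventually.of_forall fun x => ?_)
  have : ((-(2 * Real.pi * inner ℝ w x) : ℝ) : ℂ) = phase ζ x := by
    rw [hζ, phase_smul, phase_toC]
    conv_lhs => rw [hw, inner_neg_left, real_inner_smul_left]
    push_cast; ring
  simp only [this]

/-- The bound of `enorm_integral_exp_le`, with `ε` the norm of the linearised boundary map. -/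
def PlaneWaveBound (Ω : Set R3) (σ : R3 → ℝ) (k ε : ℝ) : Prop :=
  ∀ ζ η ζ' η' : C3, cdot ζ ζ = (k : ℂ) ^ 2 → cdot ζ' ζ' = (k : ℂ) ^ 2 →
    cdot ζ η = 0 → cdot ζ' η' = 0 → cdot η η' = 1 → ‖η‖ ≤ 1 → ‖η'‖ ≤ 1 →
    ‖cross3 ζ η‖ ≤ k → ‖cross3 ζ' η'‖ ≤ k →
    ‖∫ x in Ω, (σ x : ℂ) * Complex.exp (Complex.I * phase (ζ + ζ') x)‖ₑ ≤
      ENNReal.ofReal ε * (ENNReal.ofReal ((1 + k) * k) * (expNorm Ω ζ * expNorm Ω ζ'))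

lemma planeWaveBound {Ω : Set R3} (ho : IsOpen Ω) (hb : Bornology.IsBounded Ω)
    {ω ε₀ μ₀ : ℝ} (hω : ω ≠ 0) (hμ₀ : μ₀ ≠ 0) (hne : ¬ IsMaxwellEigenvalue Ω ω ε₀ μ₀)
    {k : ℝ} (hk : k ^ 2 = ω ^ 2 * ε₀ * μ₀) (hk1 : 1 ≤ k) {σ : R3 → ℝ} {ε : ℝ}
    (hε : linearisedMapNorm Ω ω ε₀ μ₀ σ = ENNReal.ofReal ε) : PlaneWaveBound Ω σ k ε := by
  intro ζ η ζ' η' hζ hζ' h h' hηη' hη hη' hc hc'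
  have hfin : ∀ ζ : C3, expNorm Ω ζ ≠ ∞ := fun ζ =>
    ((contDiff_exp_phase ζ).continuous.memLp_restrict_of_isBounded hb ho.measurableSet 2).2.ne
  set A := ENNReal.ofReal ((1 + k) * k) * (expNorm Ω ζ * expNorm Ω ζ') with hA
  have hAt : A ≠ ∞ :=
    ENNReal.mul_ne_top ENNReal.ofReal_ne_top (ENNReal.mul_ne_top (hfin ζ) (hfin ζ'))
  have key : ∀ C ∈ {C : ℝ≥0∞ | ∀ g ∈ TH Ω, ∃ h, LinearisedMap Ω ω ε₀ μ₀ σ g h ∧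
      normTH Ω h ≤ C * normTH Ω g},
      ‖∫ x in Ω, (σ x : ℂ) * Complex.exp (Complex.I * phase (ζ + ζ') x)‖ₑ ≤ C * A :=
    fun C hC => enorm_integral_exp_le ho hb hω hμ₀ hne hk hk1 hC hζ hζ' h h' hηη' hη hη' hc hc'
  rw [← hε]
  rcases eq_or_ne A 0 with h0 | h0
  · -- the set of admissible constants is not empty, as its infimum is finite
    have hS : {C : ℝ≥0∞ | ∀ g ∈ TH Ω, ∃ h, LinearisedMap Ω ω ε₀ μ₀ σ g h ∧
        normTH Ω h ≤ C * normTH Ω g}.Nonempty := by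
      by_contra hemp
      rw [linearisedMapNorm, Set.not_nonempty_iff_eq_empty.1 hemp, sInf_empty] at hε
      exact ENNReal.ofReal_ne_top hε.symm
    obtain ⟨C, hC⟩ := hS
    simpa [h0] using key C hC
  · rw [← ENNReal.div_le_iff_le_mul (Or.inl h0) (Or.inl hAt)]
    exact le_sInf fun C hC => ENNReal.div_le_of_le_mul (key C hC)

/-- Low frequencies: two propagating plane waves. -/
lemma norm_domainFourier_le_of_low {Ω : Set R3} (hb : Bornology.IsBounded Ω)
    {σ : R3 → ℝ} {k ε : ℝ} (hk : 0 ≤ k) (hε : 0 ≤ ε) (H : PlaneWaveBound Ω σ k ε) {w : R3}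
    (hw : Real.pi * ‖w‖ ≤ k) :
    ‖domainFourier Ω σ w‖ ≤ ε * ((1 + k) * k) * vol3 Ω := by
  obtain ⟨f₁, f₂, h₁, h₂, h₁₂, hwf⟩ := exists_frame w
  set s : ℝ := Real.pi * ‖w‖ with hs
  have hs0 : 0 ≤ s := by positivity
  set a : ℝ := Real.sqrt (k ^ 2 - s ^ 2) with ha
  have hsa : s ^ 2 + a ^ 2 = k ^ 2 := by
    rw [ha, Real.sq_sqrt (by nlinarith)]; ring
  set p : R3 := s • f₁ + a • f₂ with hp
  set q : R3 := s • f₁ + (-a) • f₂ with hq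
  set n : R3 := crossR f₁ f₂ with hn
  have hn1 : ‖n‖ = 1 := by
    have : ‖n‖ ^ 2 = 1 := by rw [hn, norm_sq_crossR, h₁, h₂, h₁₂]; norm_num
    exact (pow_eq_one_iff_of_nonneg (norm_nonneg _) two_ne_zero).1 this
  have comb : ∀ c : ℝ, s ^ 2 + c ^ 2 = k ^ 2 →
      cdot (toC (s • f₁ + c • f₂)) (toC (s • f₁ + c • f₂)) = (k : ℂ) ^ 2 ∧
      cdot (toC (s • f₁ + c • f₂)) (toC n) = 0 ∧
      ‖cross3 (toC (s • f₁ + c • f₂)) (toC n)‖ ≤ k := by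
    intro c hc
    have hin : inner ℝ (s • f₁ + c • f₂) n = (0 : ℝ) := by
      rw [inner_add_left, real_inner_smul_left, real_inner_smul_left, hn, inner_crossR_left,
        inner_crossR_right]; ring
    have hns : ‖s • f₁ + c • f₂‖ ^ 2 = k ^ 2 := by
      rw [← hc, ← real_inner_self_eq_norm_sq]
      simp only [inner_add_left, inner_add_right, real_inner_smul_left, real_inner_smul_right,
        real_inner_comm f₁ f₂, h₁₂, real_inner_self_eq_norm_sq, norm_smul, mul_pow,
        Real.norm_eq_abs, sq_abs, h₁, h₂]
      ring
    refine ⟨?_, ?_, ?_⟩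
    · rw [cdot_toC, real_inner_self_eq_norm_sq, hns]; push_cast; rfl
    · rw [cdot_toC, hin]; rfl
    · -- Lagrange's identity for the real vectors `s f₁ + c f₂ ⊥ n`
      rw [← toC_crossR, norm_toC]
      refine (sq_le_sq₀ (norm_nonneg _) hk).1 ?_
      rw [norm_sq_crossR, hns, hn1, hin]; simp
  have hE : ∀ v : R3, expNorm Ω (toC v) = (volume Ω) ^ (1 / 2 : ℝ) := fun v => by
    rw [expNorm_eq]; simp [phase_toC]
  have hsum : toC p + toC q = ((2 * Real.pi * ‖w‖ : ℝ) : ℂ) • toC f₁ := by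
    ext i; simp [hp, hq, hs]; ring
  have hb1 := comb a hsa
  have hb2 := comb (-a) (by rw [neg_sq, hsa])
  have hnn : cdot (toC n) (toC n) = 1 := by
    rw [cdot_toC, real_inner_self_eq_norm_sq, hn1]; simp
  have key := H (toC p) (toC n) (toC q) (toC n) hb1.1 hb2.1 hb1.2.1 hb2.2.1 hnn
    (by rw [norm_toC, hn1]) (by rw [norm_toC, hn1]) hb1.2.2 hb2.2.2
  rw [← domainFourier_eq hwf hsum, hE, hE, ← ENNReal.rpow_add_of_nonneg _ _ (by norm_num)
    (by norm_num), add_halves, ENNReal.rpow_one, ← ENNReal.ofReal_toReal hb.measure_lt_top.ne,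
    ← ENNReal.ofReal_mul (by positivity), ← ENNReal.ofReal_mul hε, ← ofReal_norm] at key
  have := (ENNReal.ofReal_le_ofReal_iff (by positivity)).1 key
  rw [vol3]
  linarith

/-- High frequencies: two evanescent waves, one growing and one decaying in a direction `f₂`
orthogonal to `w`. Polarised in the plane of `w` and `f₂`, they have curls of norm at most `k`
times their own, however fast they decay. -/
lemma norm_sq_domainFourier_le_of_high {Ω : Set R3} (ho : IsOpen Ω) (hb : Bornology.IsBounded Ω)
    (hΩ : Ω.Nonempty) {σ : R3 → ℝ} {k ε : ℝ} (hk : 0 < k) (hε : 0 ≤ ε)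
    (H : PlaneWaveBound Ω σ k ε) {w : R3} {τ : ℝ} (hτ : 0 < τ)
    (hw : (Real.pi * ‖w‖) ^ 2 = k ^ 2 + τ ^ 2) :
    ‖domainFourier Ω σ w‖ ^ 2 ≤ (ε * ((1 + k) * k)) ^ 2 *
      (vol2 Ω ^ 2 * (Real.exp (2 * τ * Metric.diam Ω) *
        (1 - Real.exp (-(2 * τ * Metric.diam Ω))) ^ 2 / (2 * τ) ^ 2)) := by
  obtain ⟨f₁, f₂, h₁, h₂, h₁₂, hwf⟩ := exists_frame w
  set s : ℝ := Real.pi * ‖w‖ with hs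
  set Z : ℝ := Real.sqrt (s ^ 2 + τ ^ 2) with hZ
  have hZ2 : Z ^ 2 = s ^ 2 + τ ^ 2 := Real.sq_sqrt (by positivity)
  have hZ0 : 0 < Z := Real.sqrt_pos.2 (by positivity)
  have hkZ : k ≤ Z := (sq_le_sq₀ hk.le hZ0.le).1 (by rw [hZ2, hw]; nlinarith)
  have hI := Complex.I_sq
  have hZc : (Z : ℂ) ≠ 0 := by exact_mod_cast hZ0.ne'
  have hZ2c : (Z : ℂ) ^ 2 = (s : ℂ) ^ 2 + (τ : ℂ) ^ 2 := by exact_mod_cast hZ2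
  have hwc : (s : ℂ) ^ 2 = (k : ℂ) ^ 2 + (τ : ℂ) ^ 2 := by exact_mod_cast hw
  have hn1 : ‖cross3 (toC f₁) (toC f₂)‖ = 1 := by
    rw [← toC_crossR, norm_toC]
    have : ‖crossR f₁ f₂‖ ^ 2 = 1 := by rw [norm_sq_crossR, h₁, h₂, h₁₂]; norm_num
    exact (pow_eq_one_iff_of_nonneg (norm_nonneg _) two_ne_zero).1 this
  set ζ : ℝ → C3 := fun t => (s : ℂ) • toC f₁ + (Complex.I * t) • toC f₂ with hζ
  set η : ℝ → C3 := fun t => (Complex.I * t / Z) • toC f₁ + (-(s / Z) : ℂ) • toC f₂ with hη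
  have comb : ∀ t : ℝ, t ^ 2 = τ ^ 2 → cdot (ζ t) (ζ t) = (k : ℂ) ^ 2 ∧ cdot (ζ t) (η t) = 0 ∧
      ‖η t‖ ≤ 1 ∧ ‖cross3 (ζ t) (η t)‖ ≤ k := by
    intro t ht
    have htc : (t : ℂ) ^ 2 = (τ : ℂ) ^ 2 := by exact_mod_cast ht
    refine ⟨?_, ?_, ?_, ?_⟩
    · rw [hζ, cdot_combination h₁ h₂ h₁₂]
      linear_combination hwc + (t : ℂ) ^ 2 * hI - htc
    · rw [hζ, hη, cdot_combination h₁ h₂ h₁₂]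
      ring
    · have : ‖η t‖ ^ 2 = 1 := by
        rw [hη, norm_sq_toC_add _ _ _ _ h₁₂, h₁, h₂]
        simp only [norm_div, norm_neg, norm_mul, Complex.norm_I, Complex.norm_real, Real.norm_eq_abs,
          div_pow, sq_abs, one_mul, one_pow, mul_one]
        rw [← add_div, ht, hZ2]
        exact (div_eq_one_iff_eq (by positivity)).2 (by ring)
      exact ((pow_eq_one_iff_of_nonneg (norm_nonneg _) two_ne_zero).1 this).le
    · have e : cross3 (ζ t) (η t) = ((-(k ^ 2 / Z) : ℝ) : ℂ) • cross3 (toC f₁) (toC f₂) := by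
        rw [hζ, hη, cross3_combination]
        congr 1
        push_cast
        field_simp
        linear_combination - hwc - (t : ℂ) ^ 2 * hI + htc
      rw [e, norm_smul, hn1, mul_one, Complex.norm_real, norm_neg, Real.norm_eq_abs,
        abs_of_nonneg (by positivity), div_le_iff₀ hZ0]
      nlinarith
  have hηη : cdot (η τ) (η (-τ)) = 1 := by
    rw [hη, cdot_combination h₁ h₂ h₁₂]
    push_cast
    field_simp
    linear_combination - hZ2c - (τ : ℂ) ^ 2 * hI
  have hsum : ζ τ + ζ (-τ) = ((2 * Real.pi * ‖w‖ : ℝ) : ℂ) • toC f₁ := by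
    ext i; simp [hζ, hs]; ring
  have hE : ∀ t : ℝ, expNorm Ω (ζ t) =
      (∫⁻ x in Ω, ENNReal.ofReal (Real.exp (-(2 * (t * inner ℝ f₂ x))))) ^ (1 / 2 : ℝ) := fun t => by
    rw [expNorm_eq]
    congr 1
    refine lintegral_congr fun x => ?_
    have : (phase (ζ t) x).im = t * inner ℝ f₂ x := by
      simp only [hζ, phase_add_left, phase_smul, phase_toC]
      simp
    rw [this]
  have hb1 := comb τ rfl
  have hb2 := comb (-τ) (neg_sq τ)
  have key := H (ζ τ) (η τ) (ζ (-τ)) (η (-τ)) hb1.1 hb2.1 hb1.2.1 hb2.2.1 hηη hb1.2.2.1 hb2.2.2.1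
    hb1.2.2.2 hb2.2.2.2
  rw [← domainFourier_eq hwf hsum, hE, hE, ← ENNReal.mul_rpow_of_nonneg _ _ (by norm_num),
    ← mul_assoc, ← ENNReal.ofReal_mul hε] at key
  have hprod := lintegral_exp_inner_le ho hb hΩ h₂ hτ
  have e1 : ∀ x : R3, -(2 * (τ * inner ℝ f₂ x)) = -(2 * τ * inner ℝ f₂ x) := fun x => by ring
  have e2 : ∀ x : R3, -(2 * (-τ * inner ℝ f₂ x)) = 2 * τ * inner ℝ f₂ x := fun x => by ring
  simp only [e1, e2] at key
  have key2 := key.trans (mul_le_mul_right (ENNReal.rpow_le_rpow hprod (by norm_num)) _)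
  set Q := vol2 Ω ^ 2 * (Real.exp (2 * τ * Metric.diam Ω) *
        (1 - Real.exp (-(2 * τ * Metric.diam Ω))) ^ 2 / (2 * τ) ^ 2) with hQ
  have hQ0 : 0 ≤ Q := by positivity
  rw [ENNReal.ofReal_rpow_of_nonneg hQ0 (by norm_num), ← ENNReal.ofReal_mul (by positivity),
    ← ofReal_norm, ← Real.sqrt_eq_rpow] at key2
  have := (ENNReal.ofReal_le_ofReal_iff (by positivity)).1 key2
  calc ‖domainFourier Ω σ w‖ ^ 2 ≤ (ε * ((1 + k) * k) * Real.sqrt Q) ^ 2 := by gcongr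
    _ = _ := by rw [mul_pow, Real.sq_sqrt hQ0]

/-! ### Truncating the Fourier transform -/

section Truncation
open scoped SchwartzMap FourierTransform LineDeriv

lemma fourier_eq_domainFourier {Ω : Set R3} {φ : R3 → ℝ} (hφ : IsTestFunction Ω φ) (w : R3) :
    𝓕 (fun x => (φ x : ℂ)) w = domainFourier Ω φ w := by
  rw [Real.fourier_eq', domainFourier, setIntegral_eq_integral_of_forall_compl_eq_zero]
  · refine integral_congr_ae (Filter.Eventually.of_forall fun x => ?_)
    simp only [smul_eq_mul]
    rw [mul_comm, real_inner_comm]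
    congr 2
    push_cast; ring
  · intro x hx
    simp [hφ.eq_zero hx]

lemma norm_gradient_sq (φ : R3 → ℝ) (x : R3) :
    ‖∇ φ x‖ ^ 2 = ∑ i : Fin 3, (fderiv ℝ φ x (EuclideanSpace.single i (1 : ℝ))) ^ 2 := by
  rw [EuclideanSpace.norm_sq_eq]
  refine Finset.sum_congr rfl fun i _ => ?_
  have : (∇ φ x) i = fderiv ℝ φ x (EuclideanSpace.single i (1 : ℝ)) := by
    have h := InnerProductSpace.toDual_symm_apply (𝕜 := ℝ)
      (x := EuclideanSpace.single i (1 : ℝ)) (y := fderiv ℝ φ x)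
    rw [EuclideanSpace.inner_single_right, one_mul] at h
    exact h
  rw [this, Real.norm_eq_abs, sq_abs]

/-- The high frequencies of a test function are controlled by its `H¹` norm. -/
lemma integral_sq_le_of_isTestFunction {Ω : Set R3} {φ : R3 → ℝ} (hφ : IsTestFunction Ω φ) {ρ : ℝ}
    (hρ : 0 ≤ ρ) :
    ∫ x in Ω, φ x ^ 2 ≤ (∫ w in Metric.ball (0 : R3) ρ, ‖domainFourier Ω φ w‖ ^ 2) +
      ((∫ x in Ω, φ x ^ 2) + ∫ x in Ω, ‖∇ φ x‖ ^ 2) / (1 + (2 * Real.pi * ρ) ^ 2) := by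
  have hc : HasCompactSupport (fun x => (φ x : ℂ)) := hφ.2.1.comp_left Complex.ofReal_zero
  have hs : ContDiff ℝ (⊤ : ℕ∞) (fun x => (φ x : ℂ)) := Complex.ofRealCLM.contDiff.comp hφ.1
  set f : 𝓢(R3, ℂ) := hc.toSchwartzMap hs with hf
  have hfx : ∀ x, f x = (φ x : ℂ) := fun x => rfl
  have hFx : ∀ w, 𝓕 f w = domainFourier Ω φ w := fun w => by
    rw [← fourier_eq_domainFourier hφ, SchwartzMap.fourier_coe]; rfl
  have hd : Differentiable ℝ φ := hφ.1.differentiable (by simp)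
  have hgrad0 : ∀ x ∉ Ω, ∇ φ x = 0 := fun x hx => by
    have : fderiv ℝ φ x = 0 := by
      by_contra hne
      exact hx (hφ.2.2 (support_fderiv_subset ℝ hne))
    simp [gradient, this]
  have P0 : ∫ w, ‖domainFourier Ω φ w‖ ^ 2 = ∫ x in Ω, φ x ^ 2 := by
    rw [setIntegral_eq_integral_of_forall_compl_eq_zero fun x hx => by simp [hφ.eq_zero hx]]
    have := SchwartzMap.integral_norm_sq_fourier f
    simpa [hfx, hFx] using this
  have hI : ∀ i : Fin 3, ∀ w, ‖𝓕 (∂_{EuclideanSpace.single i (1 : ℝ)} f) w‖ ^ 2 =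
      (2 * Real.pi) ^ 2 * (w i ^ 2 * ‖domainFourier Ω φ w‖ ^ 2) := by
    intro i w
    have htg : (inner ℝ · (EuclideanSpace.single i (1 : ℝ)) : R3 → ℝ).HasTemperateGrowth := by
      fun_prop
    rw [SchwartzMap.fourier_lineDerivOp_eq, smul_apply,
      SchwartzMap.smulLeftCLM_apply_apply htg, hFx, norm_smul, norm_smul,
      EuclideanSpace.inner_single_right]
    simp [mul_pow]
  have hsq : ∀ g : 𝓢(R3, ℂ), Integrable fun x => ‖g x‖ ^ 2 := fun g =>
    (memLp_two_iff_integrable_sq_norm g.continuous.aestronglyMeasurable).1 (g.memLp 2)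
  have P1 : ∫ w, (2 * Real.pi * ‖w‖) ^ 2 * ‖domainFourier Ω φ w‖ ^ 2 =
      ∫ x in Ω, ‖∇ φ x‖ ^ 2 := by
    rw [setIntegral_eq_integral_of_forall_compl_eq_zero fun x hx => by simp [hgrad0 x hx]]
    have e1 : ∀ w, (2 * Real.pi * ‖w‖) ^ 2 * ‖domainFourier Ω φ w‖ ^ 2 =
        ∑ i : Fin 3, ‖𝓕 (∂_{EuclideanSpace.single i (1 : ℝ)} f) w‖ ^ 2 := fun w => by
      simp only [hI]
      rw [Fin.sum_univ_three, mul_pow _ ‖w‖, ← norm_sq_eq_sum]; ring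
    have e2 : ∀ x, ‖∇ φ x‖ ^ 2 =
        ∑ i : Fin 3, ‖(∂_{EuclideanSpace.single i (1 : ℝ)} f : 𝓢(R3, ℂ)) x‖ ^ 2 := fun x => by
      rw [norm_gradient_sq]
      refine Finset.sum_congr rfl fun i _ => ?_
      have : HasFDerivAt (f : R3 → ℂ) (Complex.ofRealCLM.comp (fderiv ℝ φ x)) x :=
        Complex.ofRealCLM.hasFDerivAt.comp x (hd x).hasFDerivAt
      rw [SchwartzMap.lineDerivOp_apply_eq_fderiv, this.fderiv]
      simp
    simp_rw [e1, e2]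
    rw [integral_finsetSum _ fun i _ => hsq _, integral_finsetSum _ fun i _ => hsq _]
    exact Finset.sum_congr rfl fun i _ => SchwartzMap.integral_norm_sq_fourier _
  have i0 : Integrable fun w => ‖domainFourier Ω φ w‖ ^ 2 := by
    simpa [hFx] using hsq (𝓕 f)
  have i1 : Integrable fun w => (2 * Real.pi * ‖w‖) ^ 2 * ‖domainFourier Ω φ w‖ ^ 2 := by
    have := integrable_finsetSum (Finset.univ : Finset (Fin 3)) fun i _ =>
      hsq (𝓕 (∂_{EuclideanSpace.single i (1 : ℝ)} f))
    refine this.congr (Filter.Eventually.of_forall fun w => ?_)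
    simp only [hI]
    rw [Fin.sum_univ_three, mul_pow _ ‖w‖, ← norm_sq_eq_sum]; ring
  rw [← P0, ← P1, ← integral_add i0 i1]
  rw [← integral_add_compl measurableSet_ball i0]
  gcongr
  rw [← integral_div]
  refine (setIntegral_mono_on i0.integrableOn ((i0.add i1).div_const _).integrableOn
    measurableSet_ball.compl fun w hw => ?_).trans (setIntegral_le_integral
      ((i0.add i1).div_const _) (Filter.Eventually.of_forall fun w => ?_))
  · have hw' : ρ ≤ ‖w‖ := by simpa using hw
    simp only [Pi.add_apply]
    rw [le_div_iff₀ (by positivity)]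
    have : (2 * Real.pi * ρ) ^ 2 ≤ (2 * Real.pi * ‖w‖) ^ 2 := by gcongr
    nlinarith [sq_nonneg ‖domainFourier Ω φ w‖]
  · simp only [Pi.add_apply, Pi.zero_apply]
    positivity

end Truncation

lemma norm_exp_I_mul_ofReal_eq_one (a : ℝ) : ‖Complex.exp (Complex.I * (a : ℂ))‖ = 1 := by
  rw [mul_comm, Complex.norm_exp_ofReal_mul_I]

lemma integrable_mul_exp {μ : Measure R3} {f : R3 → ℝ} (hf : Integrable f μ) (w : R3) :
    Integrable (fun x => (f x : ℂ) *
      Complex.exp (Complex.I * ((-(2 * Real.pi * inner ℝ w x) : ℝ) : ℂ))) μ := by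
  refine hf.ofReal.mul_bdd (c := 1) (Continuous.aestronglyMeasurable (by fun_prop)) ?_
  exact Filter.Eventually.of_forall fun x => (norm_exp_I_mul_ofReal_eq_one _).le

lemma norm_domainFourier_le (Ω : Set R3) (f : R3 → ℝ) (w : R3) :
    ‖domainFourier Ω f w‖ ≤ ∫ x in Ω, |f x| := by
  refine (norm_integral_le_integral_norm _).trans (le_of_eq ?_)
  refine integral_congr_ae (Filter.Eventually.of_forall fun x => ?_)
  simp only [norm_mul, norm_exp_I_mul_ofReal_eq_one, Complex.norm_real, mul_one, Real.norm_eq_abs]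

lemma continuous_domainFourier {Ω : Set R3} {f : R3 → ℝ}
    (hf : Integrable f (volume.restrict Ω)) : Continuous (domainFourier Ω f) := by
  refine continuous_of_dominated (bound := fun x => |f x|)
    (fun w => (integrable_mul_exp hf w).aestronglyMeasurable) (fun w => ?_) hf.abs ?_
  · refine Filter.Eventually.of_forall fun x => ?_
    simp only [norm_mul, norm_exp_I_mul_ofReal_eq_one, Complex.norm_real, mul_one,
      Real.norm_eq_abs, le_refl]
  · exact Filter.Eventually.of_forall fun x => by fun_prop

lemma domainFourier_sub {Ω : Set R3} {f g : R3 → ℝ} (hf : Integrable f (volume.restrict Ω))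
    (hg : Integrable g (volume.restrict Ω)) (w : R3) :
    domainFourier Ω (fun x => f x - g x) w = domainFourier Ω f w - domainFourier Ω g w := by
  rw [domainFourier, domainFourier, domainFourier,
    ← integral_sub (integrable_mul_exp hf w) (integrable_mul_exp hg w)]
  refine integral_congr_ae (Filter.Eventually.of_forall fun x => ?_)
  simp only
  push_cast; ring

lemma integral_norm_sq_eq {F : Type*} [NormedAddCommGroup F] {μ : Measure R3} {f : R3 → F}
    (hf : MemLp f 2 μ) : ∫ x, ‖f x‖ ^ 2 ∂μ = (eLpNorm f 2 μ).toReal ^ 2 := by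
  have h := hf.eLpNorm_eq_integral_rpow_norm two_ne_zero ENNReal.ofNat_ne_top
  have h0 : 0 ≤ ∫ x, ‖f x‖ ^ 2 ∂μ := integral_nonneg fun x => by positivity
  simp only [ENNReal.toReal_ofNat, Real.rpow_ofNat] at h
  rw [h, ENNReal.toReal_ofReal (by positivity), ← Real.rpow_natCast, ← Real.rpow_mul h0]
  norm_num

lemma toReal_eLpNorm_le_add {F : Type*} [NormedAddCommGroup F] {μ : Measure R3} {f g : R3 → F}
    (hf : MemLp f 2 μ) (hg : AEStronglyMeasurable g μ) {δ : ℝ} (hδ : 0 ≤ δ)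
    (h : eLpNorm (fun x => f x - g x) 2 μ ≤ ENNReal.ofReal δ) :
    (eLpNorm g 2 μ).toReal ≤ (eLpNorm f 2 μ).toReal + δ := by
  have h1 : eLpNorm g 2 μ ≤ eLpNorm f 2 μ + ENNReal.ofReal δ := by
    have e : g = f - (fun x => f x - g x) := by ext x; simp
    calc eLpNorm g 2 μ = eLpNorm (f - (fun x => f x - g x)) 2 μ := by rw [← e]
      _ ≤ eLpNorm f 2 μ + eLpNorm (fun x => f x - g x) 2 μ :=
        eLpNorm_sub_le hf.1 (hf.1.sub hg) (by norm_num)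
      _ ≤ _ := by gcongr
  have := ENNReal.toReal_mono (ENNReal.add_ne_top.2 ⟨hf.2.ne, ENNReal.ofReal_ne_top⟩) h1
  rwa [ENNReal.toReal_add hf.2.ne ENNReal.ofReal_ne_top, ENNReal.toReal_ofReal hδ] at this

lemma integral_abs_le {Ω : Set R3} (hb : Bornology.IsBounded Ω) {f : R3 → ℝ}
    (hf : AEStronglyMeasurable f (volume.restrict Ω)) {δ : ℝ} (hδ : 0 ≤ δ)
    (h : eLpNorm f 2 (volume.restrict Ω) ≤ ENNReal.ofReal δ) :
    ∫ x in Ω, |f x| ≤ δ * Real.sqrt (vol3 Ω) := by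
  have h1 := eLpNorm_le_eLpNorm_mul_rpow_measure_univ (p := 1) (q := 2) (by norm_num) hf
  have e : 1 / (1 : ℝ≥0∞).toReal - 1 / (2 : ℝ≥0∞).toReal = 1 / 2 := by norm_num
  rw [e] at h1
  have h2 : ∫ x in Ω, |f x| = (eLpNorm f 1 (volume.restrict Ω)).toReal := by
    rw [eLpNorm_one_eq_lintegral_enorm, ← integral_norm_eq_lintegral_enorm hf]
    rfl
  rw [h2]
  refine ENNReal.toReal_le_of_le_ofReal (by positivity) (h1.trans ?_)
  rw [ENNReal.ofReal_mul hδ, Measure.restrict_apply_univ, vol3, Real.sqrt_eq_rpow,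
    ← ENNReal.ofReal_rpow_of_nonneg ENNReal.toReal_nonneg (by norm_num),
    ENNReal.ofReal_toReal hb.measure_lt_top.ne]
  gcongr

lemma IsTestFunction.continuous_gradient {Ω : Set R3} {φ : R3 → ℝ} (hφ : IsTestFunction Ω φ) :
    Continuous (∇ φ) := by
  have : Continuous (fderiv ℝ φ) := hφ.1.continuous_fderiv (by simp)
  exact (InnerProductSpace.toDual ℝ R3).symm.continuous.comp this

/-- Functions of `H¹₀(Ω)` satisfy the estimate of `integral_sq_le_of_isTestFunction`. -/
lemma SobolevH1.integral_sq_le {Ω : Set R3} (ho : IsOpen Ω) (hb : Bornology.IsBounded Ω)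
    (σ : SobolevH1 Ω) (hσ0 : σ.VanishesOnBoundary) {ρ : ℝ} (hρ : 0 ≤ ρ) :
    ∫ x in Ω, σ.val x ^ 2 ≤
      (∫ w in Metric.ball (0 : R3) ρ, ‖domainFourier Ω σ.val w‖ ^ 2) +
      σ.norm ^ 2 / (1 + (2 * Real.pi * ρ) ^ 2) := by
  have hfin : IsFiniteMeasure (volume.restrict Ω) := ⟨by simpa using hb.measure_lt_top⟩
  set N := (eLpNorm σ.val 2 (volume.restrict Ω)).toReal with hN
  set N' := (eLpNorm σ.grad 2 (volume.restrict Ω)).toReal with hN'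
  have sqnorm : ∀ {f : R3 → ℝ}, MemLp f 2 (volume.restrict Ω) →
      ∫ x in Ω, f x ^ 2 = (eLpNorm f 2 (volume.restrict Ω)).toReal ^ 2 := fun hf => by
    simpa using integral_norm_sq_eq hf
  have hσN : σ.norm ^ 2 = N ^ 2 + N' ^ 2 := by
    rw [SobolevH1.norm, sqnorm σ.memLp_val, integral_norm_sq_eq σ.memLp_grad,
      Real.sq_sqrt (by positivity)]
  rw [sqnorm σ.memLp_val, hσN]
  set I := ∫ w in Metric.ball (0 : R3) ρ, ‖domainFourier Ω σ.val w‖ ^ 2 with hI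
  set T := 1 + (2 * Real.pi * ρ) ^ 2 with hT
  have hT0 : 0 < T := by positivity
  set B := ∫ x in Ω, |σ.val x| with hB
  have hB0 : 0 ≤ B := integral_nonneg fun x => abs_nonneg _
  set V := Real.sqrt (vol3 Ω) with hV
  have hV0 : 0 ≤ V := Real.sqrt_nonneg _
  set W := volume.real (Metric.ball (0 : R3) ρ) with hW
  have hσi : Integrable σ.val (volume.restrict Ω) := σ.memLp_val.integrable one_le_two
  have key : ∀ δ : ℝ, 0 < δ → N ^ 2 ≤ (I + W * (2 * B * (δ * V) + (δ * V) ^ 2)) +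
      ((N + δ) ^ 2 + (N' + δ) ^ 2) / T + (2 * δ * (N + δ) + δ ^ 2) := by
    intro δ hδ
    obtain ⟨φ, hφ, h1, h2⟩ := hσ0 (ENNReal.ofReal δ) (by simpa using hδ)
    have mφ := hφ.1.continuous.memLp_restrict_of_isBounded hb ho.measurableSet 2
    have mg := hφ.continuous_gradient.memLp_restrict_of_isBounded hb ho.measurableSet 2
    have hφi : Integrable φ (volume.restrict Ω) := mφ.integrable one_le_two
    have a1 := toReal_eLpNorm_le_add σ.memLp_val mφ.1 hδ.le h1.le
    have a2 := toReal_eLpNorm_le_add σ.memLp_grad mg.1 hδ.le h2.le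
    have a3 := toReal_eLpNorm_le_add mφ σ.memLp_val.1 hδ.le (by
      refine le_trans (le_of_eq ?_) h1.le
      exact eLpNorm_sub_comm _ _ _ _)
    have a4 := integral_abs_le hb (σ.memLp_val.1.sub mφ.1) hδ.le h1.le
    have a5 := integral_sq_le_of_isTestFunction hφ hρ
    rw [sqnorm mφ, integral_norm_sq_eq mg] at a5
    set n := (eLpNorm φ 2 (volume.restrict Ω)).toReal with hn
    set n' := (eLpNorm (∇ φ) 2 (volume.restrict Ω)).toReal with hn'
    have hn0 : 0 ≤ n := ENNReal.toReal_nonneg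
    have hn0' : 0 ≤ n' := ENNReal.toReal_nonneg
    have hN0 : 0 ≤ N := ENNReal.toReal_nonneg
    have a6 : ∫ w in Metric.ball (0 : R3) ρ, ‖domainFourier Ω φ w‖ ^ 2 ≤
        I + W * (2 * B * (δ * V) + (δ * V) ^ 2) := by
      have cσ := continuous_domainFourier hσi
      have cφ := continuous_domainFourier hφi
      have ib : ∀ g : R3 → ℝ, Continuous g → IntegrableOn g (Metric.ball (0 : R3) ρ) :=
        fun g hg => (hg.continuousOn.integrableOn_compact
          (isCompact_closedBall (0 : R3) ρ)).mono_set Metric.ball_subset_closedBall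
      have e : W * (2 * B * (δ * V) + (δ * V) ^ 2) =
          ∫ w in Metric.ball (0 : R3) ρ, (2 * B * (δ * V) + (δ * V) ^ 2) := by
        rw [setIntegral_const, smul_eq_mul]
      rw [e, hI, ← integral_add (ib _ (by fun_prop)) (ib _ (by fun_prop))]
      refine integral_mono (ib _ (by fun_prop)) (ib _ (by fun_prop)) fun w => ?_
      have d1 : ‖domainFourier Ω σ.val w - domainFourier Ω φ w‖ ≤ δ * V := by
        rw [← domainFourier_sub hσi hφi]
        exact (norm_domainFourier_le _ _ _).trans a4
      have d2 := norm_domainFourier_le Ω σ.val w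
      have d3 : ‖domainFourier Ω φ w‖ ≤ ‖domainFourier Ω σ.val w‖ + δ * V := by
        have := norm_sub_norm_le (domainFourier Ω φ w) (domainFourier Ω σ.val w)
        rw [norm_sub_rev] at this
        linarith
      have d4 : 0 ≤ δ * V := by positivity
      calc ‖domainFourier Ω φ w‖ ^ 2 ≤ (‖domainFourier Ω σ.val w‖ + δ * V) ^ 2 := by gcongr
        _ ≤ _ := by nlinarith
    have a7 : (n ^ 2 + n' ^ 2) / T ≤ ((N + δ) ^ 2 + (N' + δ) ^ 2) / T := by gcongr
    have a8 : N ^ 2 ≤ (n + δ) ^ 2 := by gcongr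
    have a9 : δ * n ≤ δ * (N + δ) := by gcongr
    nlinarith
  have lim : Filter.Tendsto (fun δ : ℝ => (I + W * (2 * B * (δ * V) + (δ * V) ^ 2)) +
      ((N + δ) ^ 2 + (N' + δ) ^ 2) / T + (2 * δ * (N + δ) + δ ^ 2)) (nhdsWithin 0 (Set.Ioi 0))
      (nhds (I + (N ^ 2 + N' ^ 2) / T)) := by
    have hc : Continuous (fun δ : ℝ => (I + W * (2 * B * (δ * V) + (δ * V) ^ 2)) +
      ((N + δ) ^ 2 + (N' + δ) ^ 2) / T + (2 * δ * (N + δ) + δ ^ 2)) := by fun_prop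
    have := (hc.tendsto 0).mono_left (nhdsWithin_le_nhds (s := Set.Ioi 0))
    simpa using this
  exact ge_of_tendsto lim (by filter_upwards [self_mem_nhdsWithin] with δ hδ using key δ hδ)

/-! ### Integration over balls and annuli -/

lemma volume_real_ball_R3 {r : ℝ} (hr : 0 ≤ r) :
    volume.real (Metric.ball (0 : R3) r) = 4 / 3 * Real.pi * r ^ 3 := by
  rw [Measure.real, EuclideanSpace.volume_ball_fin_three, ← ENNReal.ofReal_pow hr,
    ← ENNReal.ofReal_mul (by positivity), ENNReal.toReal_ofReal (by positivity)]
  ring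

/-- Integration over an annulus of a function with a radial bound `g'(‖w‖) / ‖w‖²`. -/
lemma setIntegral_annulus_le {F : R3 → ℝ} (hF : Continuous F) {a b : ℝ} (ha : 0 < a) (hab : a ≤ b)
    {g g' : ℝ → ℝ} (hg : ContinuousOn g (Set.Icc a b))
    (hg' : ∀ y ∈ Set.Ioo a b, HasDerivAt g (g' y) y) (hpos : ∀ y ∈ Set.Ioo a b, 0 ≤ g' y)
    (hFg : ∀ w : R3, ‖w‖ ∈ Set.Ioo a b → F w ≤ g' ‖w‖ / ‖w‖ ^ 2) :
    ∫ w in {w : R3 | ‖w‖ ∈ Set.Ioo a b}, F w ≤ 4 * Real.pi * (g b - g a) := by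
  have hm : MeasurableSet {w : R3 | ‖w‖ ∈ Set.Ioo a b} := measurable_norm measurableSet_Ioo
  have hfin : Module.finrank ℝ R3 = 3 := by simp
  set G : ℝ → ℝ := (Set.Ioo a b).indicator fun y => g' y / y ^ 2 with hG
  have hyG : ∀ y : ℝ, y ^ 2 * G y = (Set.Ioo a b).indicator g' y := by
    intro y
    by_cases hy : y ∈ Set.Ioo a b
    · have : y ≠ 0 := (ha.trans hy.1).ne'
      simp only [hG, Set.indicator_of_mem hy]
      field_simp
    · simp [hG, hy]
  have hsub : Set.Ioo a b ⊆ Set.Ioi 0 := fun y hy => ha.trans hy.1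
  have hint : IntegrableOn g' (Set.Ioo a b) :=
    (intervalIntegral.integrableOn_deriv_of_nonneg hg hg' hpos).mono_set Set.Ioo_subset_Ioc_self
  have hGi : Integrable fun w : R3 => G ‖w‖ := by
    rw [integrable_fun_norm_addHaar, hfin]
    simp only [Nat.add_one_sub_one, smul_eq_mul, hyG]
    exact (hint.integrable_indicator measurableSet_Ioo).integrableOn
  have hFi : IntegrableOn F {w : R3 | ‖w‖ ∈ Set.Ioo a b} :=
    (hF.continuousOn.integrableOn_compact (isCompact_closedBall (0 : R3) b)).mono_set
      fun w hw => by simpa using hw.2.le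
  calc ∫ w in {w : R3 | ‖w‖ ∈ Set.Ioo a b}, F w
      ≤ ∫ w in {w : R3 | ‖w‖ ∈ Set.Ioo a b}, G ‖w‖ :=
        setIntegral_mono_on hFi hGi.integrableOn hm fun w hw => by
          rw [hG, Set.indicator_of_mem (s := Set.Ioo a b) hw]; exact hFg w hw
    _ = ∫ w : R3, G ‖w‖ := setIntegral_eq_integral_of_forall_compl_eq_zero fun w hw =>
        Set.indicator_of_notMem (s := Set.Ioo a b) hw _
    _ = 4 * Real.pi * ∫ y in Set.Ioo a b, g' y := by
        rw [integral_fun_norm_addHaar, hfin, volume_real_ball_R3 zero_le_one]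
        simp only [Nat.add_one_sub_one, smul_eq_mul, hyG, nsmul_eq_mul]
        rw [setIntegral_indicator measurableSet_Ioo, Set.inter_eq_right.2 hsub]
        push_cast
        ring
    _ = _ := by
        congr 1
        rw [← integral_Ioc_eq_integral_Ioo, ← intervalIntegral.integral_of_le hab]
        exact intervalIntegral.integral_eq_sub_of_hasDerivAt_of_le hab hg hg'
          ((intervalIntegrable_iff_integrableOn_Ioo_of_le hab).2 hint)

lemma setIntegral_le_of_subset_ball {F : R3 → ℝ} (hF : Continuous F) {r c : ℝ} (hr : 0 ≤ r)
    (hc : 0 ≤ c) {S : Set R3} (hS : MeasurableSet S) (hSr : S ⊆ Metric.closedBall 0 r)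
    (h : ∀ w ∈ S, F w ≤ c) : ∫ w in S, F w ≤ c * (4 / 3 * Real.pi * r ^ 3) := by
  have hfinS : volume S ≠ ∞ := ((measure_mono hSr).trans_lt measure_closedBall_lt_top).ne
  calc ∫ w in S, F w ≤ ∫ w in S, c :=
        setIntegral_mono_on ((hF.continuousOn.integrableOn_compact
          (isCompact_closedBall (0 : R3) r)).mono_set hSr) (integrableOn_const hfinS) hS h
    _ = c * volume.real S := by rw [setIntegral_const, smul_eq_mul, mul_comm]
    _ ≤ c * volume.real (Metric.closedBall (0 : R3) r) := by
        gcongr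
        exact measure_closedBall_lt_top.ne
    _ = _ := by
        rw [Measure.real, Measure.addHaar_closedBall_eq_addHaar_ball, ← volume_real_ball_R3 hr,
          Measure.real]

/-- Cancels the singularity `1 / s²` at `s = 2 τ D = 0` of the squared product of the norms of the
evanescent waves to `1 / s`, which the Jacobian of `s` as a function of the frequency absorbs. The
constant `2` is what the final estimate needs when `k` is large. -/
lemma two_mul_one_sub_exp_neg_sq_le {s : ℝ} (hs : 0 ≤ s) : 2 * (1 - Real.exp (-s)) ^ 2 ≤ s := by
  have h0 : 0 ≤ 1 - Real.exp (-s) := by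
    have := Real.exp_le_one_iff.2 (neg_nonpos.2 hs); linarith
  have h1 : 1 - Real.exp (-s) ≤ s := by linarith [Real.add_one_le_exp (-s)]
  have h2 : 1 - Real.exp (-s) ≤ 1 := by linarith [Real.exp_pos (-s)]
  rcases le_total s (1 / 2) with h | h
  · nlinarith
  rcases le_total 2 s with h' | h'
  · nlinarith
  -- on `[1/2, 2]`, bound `exp (-s)` below by (a multiple of) its tangent at `s = 1`
  have h3 : 1 - Real.exp (-s) ≤ 1 - 0.36 * (2 - s) := by
    have e1 : Real.exp (-s) = Real.exp (-1) * Real.exp (1 - s) := by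
      rw [← Real.exp_add]; ring_nf
    have e2 : (0.36 : ℝ) ≤ Real.exp (-1) := by
      linarith [Real.exp_neg_one_gt_d9]
    have e3 : 2 - s ≤ Real.exp (1 - s) := by linarith [Real.add_one_le_exp (1 - s)]
    have : 0.36 * (2 - s) ≤ Real.exp (-1) * Real.exp (1 - s) := by gcongr
    linarith
  have h4 : (1 - Real.exp (-s)) ^ 2 ≤ (1 - 0.36 * (2 - s)) ^ 2 := by gcongr
  nlinarith

/-! ### The two frequency regimes -/

/-- The low frequencies contribute at most `Vol² ε²` times the volume of a ball. -/
lemma setIntegral_low_le {Ω : Set R3} (hb : Bornology.IsBounded Ω)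
    {σ : R3 → ℝ} (hσ : Integrable σ (volume.restrict Ω)) {k ε : ℝ} (hk : 0 ≤ k) (hε : 0 ≤ ε)
    (H : PlaneWaveBound Ω σ k ε) {r : ℝ} (hr : 0 ≤ r) (hrk : r ≤ k) {S : Set R3}
    (hS : MeasurableSet S) (hSr : S ⊆ Metric.closedBall 0 (r / Real.pi)) :
    ∫ w in S, ‖domainFourier Ω σ w‖ ^ 2 ≤
      4 / (3 * Real.pi ^ 2) * vol3 Ω ^ 2 * ((1 + k) ^ 2 * k ^ 2 * r ^ 3) * ε ^ 2 := by
  have hpi := Real.pi_pos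
  refine (setIntegral_le_of_subset_ball ((continuous_domainFourier hσ).norm.pow 2)
    (c := (ε * ((1 + k) * k) * vol3 Ω) ^ 2) (by positivity) (by positivity) hS hSr
    fun w hw => ?_).trans (le_of_eq ?_)
  · have : ‖w‖ ≤ r / Real.pi := by simpa using hSr hw
    have := (le_div_iff₀ hpi).1 this
    simp only [Pi.pow_apply]
    gcongr
    exact norm_domainFourier_le_of_low hb hk hε H (by linarith)
  · field_simp

/-- The high frequencies, up to those for which the growth `exp(2 τ D)` of the evanescent waves
across `Ω` reaches `exp e`. -/
lemma setIntegral_high_le {Ω : Set R3} (ho : IsOpen Ω) (hb : Bornology.IsBounded Ω)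
    (hΩ : Ω.Nonempty) {σ : R3 → ℝ} (hσ : Integrable σ (volume.restrict Ω)) {k ε : ℝ} (hk : 0 < k)
    (hε : 0 ≤ ε) (H : PlaneWaveBound Ω σ k ε) {D e R : ℝ} (hD : D = Metric.diam Ω) (hD0 : 0 < D)
    (he : 0 ≤ e) (hR0 : 0 ≤ R) (hR : R ^ 2 = 4 * k ^ 2 + e ^ 2 / D ^ 2) :
    ∫ w in {w : R3 | ‖w‖ ∈ Set.Ioo (k / Real.pi) (R / (2 * Real.pi))},
        ‖domainFourier Ω σ w‖ ^ 2 ≤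
      (ε * ((1 + k) * k)) ^ 2 * vol2 Ω ^ 2 * R * Real.exp e / (4 * Real.pi ^ 2) := by
  have hpi := Real.pi_pos
  set b := R / (2 * Real.pi) with hb'
  set c := (ε * ((1 + k) * k)) ^ 2 * vol2 Ω ^ 2 / (8 * Real.pi ^ 2) * b with hc
  have hb0 : 0 ≤ b := by positivity
  have hc0 : 0 ≤ c := by positivity
  -- `g'(‖w‖) / ‖w‖²` dominates `|σ̂(w)|²` once a factor `‖w‖` is bounded by `b`, and it is the
  -- polar density of an exact derivative, because `π² y / τ` is the derivative of `τ`
  set τ : ℝ → ℝ := fun y => Real.sqrt ((Real.pi * y) ^ 2 - k ^ 2) with hτ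
  set g : ℝ → ℝ := fun y => c * Real.exp (2 * D * τ y) with hg
  set g' : ℝ → ℝ := fun y => c * (Real.exp (2 * D * τ y) * (2 * D * (Real.pi ^ 2 * y / τ y)))
    with hg'
  have hab : k / Real.pi ≤ b := by
    rw [hb', div_le_div_iff₀ hpi (by positivity)]
    have : 2 * k ≤ R := by
      refine (sq_le_sq₀ (by positivity) hR0).1 ?_
      rw [hR]
      have : 0 ≤ e ^ 2 / D ^ 2 := by positivity
      nlinarith
    nlinarith
  have hpos : ∀ y ∈ Set.Ioo (k / Real.pi) b, 0 < (Real.pi * y) ^ 2 - k ^ 2 := by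
    intro y hy
    have := (div_lt_iff₀ hpi).1 hy.1
    nlinarith
  have hy0 : ∀ y ∈ Set.Ioo (k / Real.pi) b, 0 < y := fun y hy => lt_trans (by positivity) hy.1
  have main := setIntegral_annulus_le ((continuous_domainFourier hσ).norm.pow 2)
    (a := k / Real.pi) (by positivity) hab (g := g) (g' := g')
    (Continuous.continuousOn (by fun_prop)) ?_ ?_ ?_
  · refine main.trans ?_
    have e1 : g b = c * Real.exp e := by
      have : τ b = e / (2 * D) := by
        have h1 : (Real.pi * b) ^ 2 - k ^ 2 = (e / (2 * D)) ^ 2 := by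
          rw [hb', show Real.pi * (R / (2 * Real.pi)) = R / 2 by field_simp, div_pow, hR]
          field_simp; ring
        simp only [hτ]
        rw [h1, Real.sqrt_sq (by positivity)]
      simp only [hg, this]
      congr 2
      field_simp
    have e2 : 0 ≤ g (k / Real.pi) := by simp only [hg]; positivity
    calc 4 * Real.pi * (g b - g (k / Real.pi)) ≤ 4 * Real.pi * g b := by gcongr; linarith
      _ = _ := by rw [e1, hc, hb']; field_simp; ring
  · intro y hy
    have h1 : HasDerivAt (fun y : ℝ => (Real.pi * y) ^ 2 - k ^ 2) (2 * Real.pi ^ 2 * y) y := by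
      refine ((((hasDerivAt_id y).const_mul Real.pi).pow 2).sub_const (k ^ 2)).congr_deriv ?_
      simp; ring
    refine ((((h1.sqrt (hpos y hy).ne').const_mul (2 * D)).exp).const_mul c).congr_deriv ?_
    simp only [hg', hτ]
    congr 3
    have := (Real.sqrt_pos.2 (hpos y hy)).ne'
    field_simp
  · intro y hy
    have := hy0 y hy
    simp only [hg', hτ]
    positivity
  · intro w hw
    set y := ‖w‖ with hy
    have hyp := hy0 y hw
    have ht : 0 < τ y := Real.sqrt_pos.2 (hpos y hw)
    have ht2 : (Real.pi * y) ^ 2 = k ^ 2 + τ y ^ 2 := by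
      simp only [hτ]; rw [Real.sq_sqrt (hpos y hw).le]; ring
    have h1 := norm_sq_domainFourier_le_of_high ho hb hΩ hk hε H ht ht2
    rw [← hD] at h1
    refine h1.trans ?_
    set t := τ y
    have h2 := two_mul_one_sub_exp_neg_sq_le (s := 2 * t * D) (by positivity)
    have hX := Real.exp_pos (2 * t * D)
    calc (ε * ((1 + k) * k)) ^ 2 * (vol2 Ω ^ 2 * (Real.exp (2 * t * D) *
          (1 - Real.exp (-(2 * t * D))) ^ 2 / (2 * t) ^ 2))
        ≤ (ε * ((1 + k) * k)) ^ 2 * (vol2 Ω ^ 2 * (Real.exp (2 * t * D) *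
          (2 * t * D / 2) / (2 * t) ^ 2)) := by gcongr; linarith
      _ = (ε * ((1 + k) * k)) ^ 2 * vol2 Ω ^ 2 / (8 * Real.pi ^ 2) * y *
          (Real.exp (2 * t * D) * (2 * D * (Real.pi ^ 2 * y / t))) / y ^ 2 := by
          field_simp; ring
      _ ≤ (ε * ((1 + k) * k)) ^ 2 * vol2 Ω ^ 2 / (8 * Real.pi ^ 2) * b *
          (Real.exp (2 * t * D) * (2 * D * (Real.pi ^ 2 * y / t))) / y ^ 2 := by
          gcongr; exact hw.2.le
      _ = _ := by
          simp only [hg', hc]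
          rw [show 2 * t * D = 2 * D * t by ring]

/-! ### The stability estimate -/

theorem theorem1 (Ω : Set R3) (hΩ : IsBoundedC2Domain Ω)
    (ε₀ μ₀ ω k : ℝ) (hε₀ : 0 < ε₀) (hμ₀ : 0 < μ₀) (hk : k = ω * Real.sqrt (ε₀ * μ₀))
    (hk1 : 1 ≤ k) (hω : ¬ IsMaxwellEigenvalue Ω ω ε₀ μ₀)
    (σ : SobolevH1 Ω) (hσ : MemLp σ.val ∞ (volume.restrict Ω))
    (M₁ : ℝ) (hM₁ : σ.norm ≤ M₁) (hσ0 : σ.VanishesOnBoundary)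
    (α : ℝ) (hα0 : 0 < α) (hα1 : α ≤ 1)
    (ε : ℝ) (hε : linearisedMapNorm Ω ω ε₀ μ₀ σ.val = ENNReal.ofReal ε)
    (hε0 : 0 < ε) (hε1 : ε < 1)
    (D : ℝ) (hD : D = Metric.diam Ω) (e : ℝ) (he : e = - Real.log ε) :
    ∫ x in Ω, σ.val x ^ 2 ≤
      4 / (3 * Real.pi ^ 2) * vol3 Ω ^ 2 *
          ((1 - chi k e) * (1 + k) ^ 4 * k ^ (3 * α) + chi k e * (1 + e) ^ 4 * e ^ 3) * ε ^ 2
      + chi k e * (1 / (4 * Real.pi ^ 2)) * vol2 Ω ^ 2 * (1 / D) * Real.sqrt (1 + (2 * D) ^ 2) *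
          (1 + e) ^ 4 * e * ε
      + M₁ ^ 2 * ((1 - chi k e) * (1 / (1 + 2 * e ^ (2 * α) + 2 * k ^ (2 * α)))
          + chi k e * (1 / (1 + e ^ 2 / D ^ 2 + 4 * k ^ 2))) := by
  have ho := hΩ.isOpen
  have hb := hΩ.isBounded
  have hne := hΩ.isConnected.nonempty
  have hpi := Real.pi_pos
  have hk0 : 0 < k := by linarith
  have he0 : 0 < e := by rw [he]; linarith [Real.log_neg hε0 hε1]
  have hexp : Real.exp e = ε⁻¹ := by rw [he, Real.exp_neg, Real.exp_log hε0]
  have hfin : IsFiniteMeasure (volume.restrict Ω) := ⟨by simpa using hb.measure_lt_top⟩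
  have hω0 : ω ≠ 0 := by rintro rfl; simp at hk; linarith
  have hk2 : k ^ 2 = ω ^ 2 * ε₀ * μ₀ := by
    rw [hk, mul_pow, Real.sq_sqrt (by positivity)]; ring
  have H := planeWaveBound ho hb hω0 hμ₀.ne' hω hk2 hk1 hε
  have hσi : Integrable σ.val (volume.restrict Ω) := σ.memLp_val.integrable one_le_two
  have hσn : σ.norm ^ 2 ≤ M₁ ^ 2 := pow_le_pow_left₀ (Real.sqrt_nonneg _) hM₁ 2
  have hkk : (1 + k) ^ 2 * k ^ 2 ≤ (1 + k) ^ 4 := by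
    have : k ^ 2 ≤ (1 + k) ^ 2 := by gcongr; linarith
    calc (1 + k) ^ 2 * k ^ 2 ≤ (1 + k) ^ 2 * (1 + k) ^ 2 := by gcongr
      _ = _ := by ring
  by_cases hek : e < k
  · -- only propagating waves: `R² = 2 e^(2α) + 2 k^(2α) ≤ (2 k)²`
    have hchi : chi k e = 0 := if_pos hek
    set R := Real.sqrt (2 * e ^ (2 * α) + 2 * k ^ (2 * α)) with hR
    have hsq : R ^ 2 = 2 * e ^ (2 * α) + 2 * k ^ (2 * α) := Real.sq_sqrt (by positivity)
    have hkα : (k ^ α) ^ 2 = k ^ (2 * α) := by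
      rw [← Real.rpow_natCast, ← Real.rpow_mul hk0.le]; push_cast; ring_nf
    have hRk : R ≤ 2 * k ^ α := by
      refine (sq_le_sq₀ (Real.sqrt_nonneg _) (by positivity)).1 ?_
      have : e ^ (2 * α) ≤ k ^ (2 * α) := Real.rpow_le_rpow he0.le hek.le (by positivity)
      rw [hsq, mul_pow, hkα]
      linarith
    have hkα1 : k ^ α ≤ k := by
      simpa using Real.rpow_le_rpow_of_exponent_le hk1 hα1
    have hkα3 : (k ^ α) ^ 3 = k ^ (3 * α) := by
      rw [← Real.rpow_natCast, ← Real.rpow_mul hk0.le]; push_cast; ring_nf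
    have h1 := σ.integral_sq_le ho hb hσ0 (ρ := R / (2 * Real.pi)) (by positivity)
    rw [show 2 * Real.pi * (R / (2 * Real.pi)) = R by field_simp, hsq] at h1
    have h2 := setIntegral_low_le hb hσi hk0.le hε0.le H (r := k ^ α) (by positivity) hkα1
      (S := Metric.ball (0 : R3) (R / (2 * Real.pi))) measurableSet_ball
      (Metric.ball_subset_closedBall.trans (Metric.closedBall_subset_closedBall (by
        rw [div_le_div_iff₀ (by positivity) hpi]; nlinarith)))
    rw [hkα3] at h2
    have h3 : 4 / (3 * Real.pi ^ 2) * vol3 Ω ^ 2 * ((1 + k) ^ 2 * k ^ 2 * k ^ (3 * α)) * ε ^ 2 ≤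
        4 / (3 * Real.pi ^ 2) * vol3 Ω ^ 2 * ((1 + k) ^ 4 * k ^ (3 * α)) * ε ^ 2 := by gcongr
    have h4 : σ.norm ^ 2 / (1 + (2 * e ^ (2 * α) + 2 * k ^ (2 * α))) ≤
        M₁ ^ 2 / (1 + (2 * e ^ (2 * α) + 2 * k ^ (2 * α))) := by gcongr
    rw [hchi]
    calc ∫ x in Ω, σ.val x ^ 2 ≤ 4 / (3 * Real.pi ^ 2) * vol3 Ω ^ 2 *
          ((1 + k) ^ 4 * k ^ (3 * α)) * ε ^ 2 +
          M₁ ^ 2 / (1 + (2 * e ^ (2 * α) + 2 * k ^ (2 * α))) := by linarith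
      _ = _ := by rw [← add_assoc]; ring
  · have hke : k ≤ e := not_lt.1 hek
    have hchi : chi k e = 1 := if_neg hek
    have hD0 : 0 < D := by
      rw [hD]
      refine Metric.diam_nonneg.lt_of_ne' fun h0 => ?_
      -- a nonempty open set of diameter zero would be an open singleton
      obtain ⟨x, hx⟩ := hne
      have hsub : Ω = {x} := Set.eq_singleton_iff_unique_mem.2 ⟨hx, fun y hy =>
        dist_le_zero.1 ((Metric.dist_le_diam_of_mem hb hy hx).trans h0.le)⟩
      have := ho.measure_pos volume ⟨x, hx⟩
      rw [hsub, measure_singleton] at this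
      exact lt_irrefl _ this
    set R := Real.sqrt (4 * k ^ 2 + e ^ 2 / D ^ 2) with hR
    have hR0 : 0 ≤ R := Real.sqrt_nonneg _
    have hsq : R ^ 2 = 4 * k ^ 2 + e ^ 2 / D ^ 2 := Real.sq_sqrt (by positivity)
    have hRD : R ≤ e * (1 / D) * Real.sqrt (1 + (2 * D) ^ 2) := by
      refine (sq_le_sq₀ hR0 (by positivity)).1 ?_
      rw [hsq, mul_pow, Real.sq_sqrt (by positivity)]
      have : 4 * k ^ 2 ≤ 4 * e ^ 2 := by gcongr
      calc 4 * k ^ 2 + e ^ 2 / D ^ 2 ≤ 4 * e ^ 2 + e ^ 2 / D ^ 2 := by gcongr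
        _ = _ := by field_simp; ring
    have h1 := σ.integral_sq_le ho hb hσ0 (ρ := R / (2 * Real.pi)) (by positivity)
    rw [show 2 * Real.pi * (R / (2 * Real.pi)) = R by field_simp, hsq] at h1
    have hcont := (continuous_domainFourier hσi).norm.pow 2
    have hball : IntegrableOn (fun w => ‖domainFourier Ω σ.val w‖ ^ 2)
        (Metric.ball (0 : R3) (R / (2 * Real.pi))) :=
      (hcont.continuousOn.integrableOn_compact (isCompact_closedBall (0 : R3) _)).mono_set
        Metric.ball_subset_closedBall
    have hdiff : Metric.ball (0 : R3) (R / (2 * Real.pi)) \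
        Metric.closedBall (0 : R3) (k / Real.pi) =
        {w : R3 | ‖w‖ ∈ Set.Ioo (k / Real.pi) (R / (2 * Real.pi))} := by
      ext w; simp [and_comm]
    rw [← integral_inter_add_sdiff (Metric.isClosed_closedBall (x := (0 : R3))
      (ε := k / Real.pi)).measurableSet hball, hdiff] at h1
    have h2 := setIntegral_low_le hb hσi hk0.le hε0.le H hk0.le le_rfl
      (S := Metric.ball (0 : R3) (R / (2 * Real.pi)) ∩ Metric.closedBall 0 (k / Real.pi))
      (measurableSet_ball.inter measurableSet_closedBall) Set.inter_subset_right
    have h3 := setIntegral_high_le ho hb hne hσi hk0 hε0.le H hD hD0 he0.le hR0 hsq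
    have hke4 : (1 + k) ^ 2 * k ^ 2 ≤ (1 + e) ^ 4 := hkk.trans (by gcongr)
    have h4 : 4 / (3 * Real.pi ^ 2) * vol3 Ω ^ 2 * ((1 + k) ^ 2 * k ^ 2 * k ^ 3) * ε ^ 2 ≤
        4 / (3 * Real.pi ^ 2) * vol3 Ω ^ 2 * ((1 + e) ^ 4 * e ^ 3) * ε ^ 2 := by gcongr
    have h5 : (ε * ((1 + k) * k)) ^ 2 * vol2 Ω ^ 2 * R * Real.exp e / (4 * Real.pi ^ 2) ≤
        1 / (4 * Real.pi ^ 2) * vol2 Ω ^ 2 * (1 / D) * Real.sqrt (1 + (2 * D) ^ 2) *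
          (1 + e) ^ 4 * e * ε := by
      calc (ε * ((1 + k) * k)) ^ 2 * vol2 Ω ^ 2 * R * Real.exp e / (4 * Real.pi ^ 2)
          = ((1 + k) ^ 2 * k ^ 2) * R * (vol2 Ω ^ 2 * ε / (4 * Real.pi ^ 2)) := by
            rw [hexp]; field_simp
        _ ≤ (1 + e) ^ 4 * (e * (1 / D) * Real.sqrt (1 + (2 * D) ^ 2)) *
            (vol2 Ω ^ 2 * ε / (4 * Real.pi ^ 2)) := by gcongr
        _ = _ := by ring
    have h6 : σ.norm ^ 2 / (1 + (4 * k ^ 2 + e ^ 2 / D ^ 2)) ≤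
        M₁ ^ 2 / (1 + (4 * k ^ 2 + e ^ 2 / D ^ 2)) := by gcongr
    rw [hchi]
    calc ∫ x in Ω, σ.val x ^ 2 ≤
          4 / (3 * Real.pi ^ 2) * vol3 Ω ^ 2 * ((1 + e) ^ 4 * e ^ 3) * ε ^ 2 +
          1 / (4 * Real.pi ^ 2) * vol2 Ω ^ 2 * (1 / D) * Real.sqrt (1 + (2 * D) ^ 2) *
          (1 + e) ^ 4 * e * ε + M₁ ^ 2 / (1 + (4 * k ^ 2 + e ^ 2 / D ^ 2)) := by linarith
      _ = _ := by
          rw [show 1 + (4 * k ^ 2 + e ^ 2 / D ^ 2) = 1 + e ^ 2 / D ^ 2 + 4 * k ^ 2 by ring]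
          ring
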